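/- Let $0<q,q_1\le\infty$, $1\le q_0,r,r_0<\infty$, $1\le r_1\le\infty$ satisfy $1/q=1/q_0+1/q_1$ and $1/r=1/r_0+1/r_1$. Then there is a constant $C=C_{q_0,q_1,r_0,r_1}<\infty$ with the following property. Let $(\Omega,\mathcal F,\mathbb P)$ be a probability space with a filtration $(\mathcal F_n)_{n\in\mathbb N}$, $\mathbb{N}=\{0,1,2,\dots\}$. For each $k\in\mathbb Z$ let $g^{(k)}=(g^{(k)}_n)_{n\in\mathbb N}$ be a real-valued martingale, let $F^{(k)}=(F^{(k)}_{s,t})_{s\le t}$ be a real-valued two-parameter process that is adapted (that is, $F^{(k)}_{s,t}$ is $\mathcal F_t$-measurable for all $s\le t$), and let $\tau_k'\le\tau_k$ be stopping times with values in $\mathbb N\cup\{\infty\}$. Write $dg_j=g_j-g_{j-1}$, $$\Pi_{s,t}(F,g)=\sum_{s<j\le t}F_{s,j-1}\,dg_j,\qquad Sg_{s,t}=\Bigl(\sum_{s<j\le t}|dg_j|^2\Bigr)^{1/2},\qquad (\delta_sF)_{t,u}=F_{s,u}-F_{t,u},$$ $\ell^p_k a_k=(\sum_{k\in\mathbb{Z}}|a_k|^p)^{1/p}$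 for $p<\infty$ and $\ell^\infty_k a_k=\sup_{k\in\mathbb{Z}}|a_k|$, and $\|\cdot\|_p$ for the (quasi-)norm of $L^p(\Omega)$. All suprema run over integer times, and the supremum over an empty set is $0$. Then $$\Bigl\|\ell^r_k\sup_{\tau_k'\le t\le\tau_k}|\Pi_{\tau_k',t}(F^{(k)},g^{(k)})|\Bigr\|_q\le C\,\Bigl\|\ell^{r_1}_k\sup_{\tau_k'\le t<\tau_k}|F^{(k)}_{\tau_k',t}|\Bigr\|_{q_1}\Bigl\|\ell^{r_0}_k Sg^{(k)}_{\tau_k',\tau_k}\Bigr\|_{q_0}.$$ Moreover, with $$L=\Bigl\|\ell^r_k\sup_{\tau_k'\le s<t\le\tau_k}|\Pi_{s,t}(F^{(k)},g^{(k)})|\Bigr\|_q,\qquad D=\Bigl\|\ell^r_k\sup_{\tau_k'\le s<t\le\tau_k}|\Pi_{s,t}(\delta_{\tau_k'}F^{(k)},g^{(k)})|\Bigr\|_q,$$ $$B=\Bigl\|\ell^{r_1}_k\sup_{\tau_k'\le i\le j\le\tau_k}|F^{(k)}_{i,j}|\Bigr\|_{q_1}\Bigl\|\ell^{r_0}_k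 Sg^{(k)}_{\tau_k',\tau_k}\Bigr\|_{q_0},$$ one has $$L\le D+C\,B\quad\text{if }q\ge1,\qquad\qquad L^q\le D^q+(C\,B)^q\quad\text{if }q<1.$$ All quantities take values in $[0,\infty]$, with $0\cdot\infty=0$. -/

import Mathlib

open MeasureTheory
open scoped ENNReal NNReal

noncomputable section

namespace VVParaproduct

/-- The martingale difference `dg_j = g_j - g_{j-1}` (only used for `j ≥ 1`). -/
def diff (g : ℕ → ℝ) (j : ℕ) : ℝ := g j - g (j - 1)

/-- The discrete paraproduct `Π_{s,t}(F,g) = ∑_{s < j ≤ t} F_{s,j-1} dg_j`. -/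
def paraprod (F : ℕ → ℕ → ℝ) (g : ℕ → ℝ) (s t : ℕ) : ℝ :=
  ∑ j ∈ Finset.Ioc s t, F s (j - 1) * diff g j

/-- `(δ_s F)_{t,u} = F_{s,u} - F_{t,u}`. -/
def deltaFst (s : ℕ) (F : ℕ → ℕ → ℝ) : ℕ → ℕ → ℝ := fun t u => F s u - F t u

/-- The square function `Sg_{s,t} = (∑_{s < j ≤ t} |dg_j|²)^{1/2}`, with `s, t` possibly infinite. -/
def sqFun (g : ℕ → ℝ) (s t : WithTop ℕ) : ℝ≥0∞ :=
  (∑' j : {j : ℕ // s < (j : WithTop ℕ) ∧ (j : WithTop ℕ) ≤ t}, ‖diff g j‖ₑ ^ 2) ^ (1 / 2 : ℝ)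

/-- The `ℓ^r` norm, `0 < r ≤ ∞`, of a family of elements of `[0,∞]`. -/
def ellNorm {ι : Type*} (r : ℝ≥0∞) (a : ι → ℝ≥0∞) : ℝ≥0∞ :=
  if r = ∞ then ⨆ k, a k else (∑' k, a k ^ r.toReal) ^ (1 / r.toReal)

/-- `sup_{a ≤ t ≤ b} |Π_{a,t}(F,g)|`, where `t` runs through `ℕ`; the supremum is `0` if `a = ∞`
(there is no such `t` then, so that the default value in `untopD` plays no role). -/
def supParaprodFrom (F : ℕ → ℕ → ℝ) (g : ℕ → ℝ) (a b : WithTop ℕ) : ℝ≥0∞ :=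
  ⨆ (t : ℕ) (_ : a ≤ (t : WithTop ℕ) ∧ (t : WithTop ℕ) ≤ b), ‖paraprod F g (a.untopD 0) t‖ₑ

/-- `sup_{a ≤ t < b} |F_{a,t}|`, where `t` runs through `ℕ`. -/
def supFrom (F : ℕ → ℕ → ℝ) (a b : WithTop ℕ) : ℝ≥0∞ :=
  ⨆ (t : ℕ) (_ : a ≤ (t : WithTop ℕ) ∧ (t : WithTop ℕ) < b), ‖F (a.untopD 0) t‖ₑ

/-- `sup_{a ≤ s < t ≤ b} |Π_{s,t}(F,g)|`, where `s, t` run through `ℕ`. -/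
def supParaprod (F : ℕ → ℕ → ℝ) (g : ℕ → ℝ) (a b : WithTop ℕ) : ℝ≥0∞ :=
  ⨆ (s : ℕ) (t : ℕ) (_ : a ≤ (s : WithTop ℕ) ∧ s < t ∧ (t : WithTop ℕ) ≤ b),
    ‖paraprod F g s t‖ₑ

/-- `sup_{a ≤ i ≤ j ≤ b} |F_{i,j}|`, where `i, j` run through `ℕ`. -/
def supTwo (F : ℕ → ℕ → ℝ) (a b : WithTop ℕ) : ℝ≥0∞ :=
  ⨆ (i : ℕ) (j : ℕ) (_ : a ≤ (i : WithTop ℕ) ∧ i ≤ j ∧ (j : WithTop ℕ) ≤ b), ‖F i j‖ₑ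

/-- A two-parameter process `(F_{s,t})_{s ≤ t}` is adapted if `F_{s,t}` is `ℱ_t`-measurable for all
`s ≤ t`. -/
def AdaptedTwo {Ω : Type*} {m : MeasurableSpace Ω} (ℱ : Filtration ℕ m)
    (F : ℕ → ℕ → Ω → ℝ) : Prop :=
  ∀ s t : ℕ, s ≤ t → Measurable[ℱ t] (F s t)

end VVParaproduct

end

/-
The engine is a Burkholder–Davis–Gundy type estimate for martingale transforms in `L^q(ℓ^r)`,
deduced from a weak-type `(r, r)` inequality for transforms with values in `ℓ^r`: the Davis
decomposition splits each martingale into a part with predictably controlled increments, to which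
a good-`λ` argument applies, and a part of integrable variation, to which the dual Doob inequality
applies.  It is used twice.  For a one-point index set and `r = 2` the weak-type inequality is the
orthogonality of martingale increments, and the outcome is the scalar estimate in `L^r`.  Summing
that one over the index gives the weak type `(r, r)` in `ℓ^r`, and the second use gives all
exponents.

Stopping times enter by localisation: `Π_{τ',t}(F, g)` is the transform of `dg_j` restricted to
`τ' < j ≤ τ` by the adapted integrand `F_{τ',j-1}`.  The two-parameter bounds follow from
`Π_{s,t}(F) = Π_{τ',t}(F) - Π_{τ',s}(F) - Π_{s,t}(δ_{τ'} F)`.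
-/

namespace VVParaproduct

section Lp

variable {α : Type*} {_ : MeasurableSpace α} {μ : Measure α}

theorem eLpNorm_ennreal_eq {p : ℝ≥0∞} (hp : p ≠ 0) (hp' : p ≠ ∞) (f : α → ℝ≥0∞) :
    eLpNorm f p μ = (∫⁻ a, f a ^ p.toReal ∂μ) ^ (1 / p.toReal) := by
  simp [eLpNorm_eq_lintegral_rpow_enorm_toReal hp hp']

theorem eLpNorm_ennreal_rpow {p : ℝ≥0∞} (hp : p ≠ 0) (hp' : p ≠ ∞) (f : α → ℝ≥0∞) :
    eLpNorm f p μ ^ p.toReal = ∫⁻ a, f a ^ p.toReal ∂μ := by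
  lift p to ℝ≥0 using hp'
  exact eLpNorm_nnreal_pow_eq_lintegral (mod_cast hp)

theorem eLpNorm_ennreal_le_mul_of_lintegral_rpow_le {p : ℝ≥0∞} (hp : p ≠ 0) (hp' : p ≠ ∞)
    {f g : α → ℝ≥0∞} {c : ℝ≥0}
    (h : ∫⁻ a, f a ^ p.toReal ∂μ ≤ c * ∫⁻ a, g a ^ p.toReal ∂μ) :
    eLpNorm f p μ ≤ (c ^ (1 / p.toReal) : ℝ≥0) * eLpNorm g p μ := by
  rw [eLpNorm_ennreal_eq hp hp', eLpNorm_ennreal_eq hp hp',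
    ENNReal.coe_rpow_of_nonneg _ (by positivity),
    ← ENNReal.mul_rpow_of_nonneg _ _ (by positivity)]
  gcongr

theorem exists_measurable_le_eLpNorm_eq {p : ℝ≥0∞} (hp : p ≠ 0) (hp' : p ≠ ∞)
    (f : α → ℝ≥0∞) :
    ∃ h : α → ℝ≥0∞, Measurable h ∧ h ≤ f ∧ eLpNorm f p μ = eLpNorm h p μ := by
  have hp0 := ENNReal.toReal_pos hp hp'
  obtain ⟨h, hh, hle, heq⟩ := exists_measurable_le_lintegral_eq μ fun a => f a ^ p.toReal
  refine ⟨fun a => h a ^ p.toReal⁻¹, hh.pow_const _, fun a => ?_, ?_⟩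
  · exact (ENNReal.rpow_inv_le_iff hp0).2 (hle a)
  · simp only [eLpNorm_ennreal_eq hp hp', heq, ENNReal.rpow_inv_rpow hp0.ne']

theorem eLpNorm_ennreal_add_le {p : ℝ≥0∞} (hp : 1 ≤ p) (f : α → ℝ≥0∞) {g : α → ℝ≥0∞}
    (hg : AEMeasurable g μ) :
    eLpNorm (fun a => f a + g a) p μ ≤ eLpNorm f p μ + eLpNorm g p μ := by
  rcases eq_or_ne p ∞ with rfl | hp'
  · simp only [eLpNorm_exponent_top, eLpNormEssSup, enorm_eq_self]
    exact ENNReal.essSup_add_le f g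
  obtain ⟨h, hh, hle, heq⟩ := exists_measurable_le_eLpNorm_eq (μ := μ)
    (one_pos.trans_le hp).ne' hp' fun a => f a + g a
  calc eLpNorm (fun a => f a + g a) p μ = eLpNorm h p μ := heq
    _ ≤ eLpNorm (fun a => (h a - g a) + g a) p μ :=
        eLpNorm_mono_enorm fun a => le_tsub_add
    _ ≤ eLpNorm (fun a => h a - g a) p μ + eLpNorm g p μ :=
        eLpNorm_add_le (hh.aemeasurable.sub hg).aestronglyMeasurable hg.aestronglyMeasurable hp
    _ ≤ eLpNorm f p μ + eLpNorm g p μ := by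
        gcongr
        exact eLpNorm_mono_enorm fun a => tsub_le_iff_right.2 (hle a)

theorem eLpNorm_ennreal_add_rpow_le {p : ℝ≥0∞} (hp : p ≠ 0) (hp' : p ≤ 1) (f : α → ℝ≥0∞)
    {g : α → ℝ≥0∞} (hg : AEMeasurable g μ) :
    eLpNorm (fun a => f a + g a) p μ ^ p.toReal
      ≤ eLpNorm f p μ ^ p.toReal + eLpNorm g p μ ^ p.toReal := by
  have hp_top : p ≠ ∞ := ne_top_of_le_ne_top ENNReal.one_ne_top hp'
  simp only [eLpNorm_ennreal_rpow hp hp_top]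
  rw [← lintegral_add_right' _ (hg.pow_const _)]
  exact lintegral_mono fun a => ENNReal.rpow_add_le_add_rpow _ _ ENNReal.toReal_nonneg
    (ENNReal.toReal_le_of_le_ofReal zero_le_one (by simpa using hp'))

theorem eLpNorm_ennreal_sum_le {κ : Type*} {p : ℝ≥0∞} (hp : 1 ≤ p) (s : Finset κ)
    {f : κ → α → ℝ≥0∞} (hf : ∀ i ∈ s, AEMeasurable (f i) μ) :
    eLpNorm (fun a => ∑ i ∈ s, f i a) p μ ≤ ∑ i ∈ s, eLpNorm (f i) p μ := by
  simpa [Finset.sum_fn] using eLpNorm_sum_le (fun i hi => (hf i hi).aestronglyMeasurable) hp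

theorem eLpNorm_ennreal_const_mul (p : ℝ≥0∞) (c : ℝ≥0) (f : α → ℝ≥0∞) :
    eLpNorm (fun a => c * f a) p μ = c * eLpNorm f p μ := by
  rcases eq_or_ne p 0 with rfl | hp
  · simp
  rcases eq_or_ne p ∞ with rfl | hp'
  · simpa only [eLpNorm_exponent_top, eLpNormEssSup, enorm_eq_self] using ENNReal.essSup_const_mul
  have := ENNReal.toReal_pos hp hp'
  simp only [eLpNorm_ennreal_eq hp hp', ENNReal.mul_rpow_of_nonneg _ _ this.le]
  rw [lintegral_const_mul' _ _ (by finiteness), ENNReal.mul_rpow_of_nonneg _ _ (by positivity),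
    ← ENNReal.rpow_mul, mul_one_div_cancel this.ne', ENNReal.rpow_one]

theorem eLpNorm_ennreal_mul_le_top_mul (p : ℝ≥0∞) (f : α → ℝ≥0∞) {g : α → ℝ≥0∞}
    (hg : AEMeasurable g μ) :
    eLpNorm (fun a => f a * g a) p μ ≤ eLpNorm f ∞ μ * eLpNorm g p μ := by
  have hle : ∀ᵐ a ∂μ, f a ≤ eLpNorm f ∞ μ := by
    simpa [eLpNorm_exponent_top] using ae_le_eLpNormEssSup (f := f) (μ := μ)
  rcases eq_or_ne p 0 with rfl | hp
  · simp
  rcases eq_or_ne (eLpNorm f ∞ μ) ∞ with htop | hne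
  · rcases eq_or_ne (eLpNorm g p μ) 0 with h0 | h0
    · rw [h0, mul_zero, nonpos_iff_eq_zero]
      refine eLpNorm_eq_zero_of_ae_zero ?_
      filter_upwards [(eLpNorm_eq_zero_iff hg.aestronglyMeasurable hp).1 h0] with a ha
      simp [ha]
    · simp [htop, ENNReal.top_mul h0]
  · lift eLpNorm f ∞ μ to ℝ≥0 using hne with c
    rw [← eLpNorm_ennreal_const_mul]
    refine eLpNorm_mono_enorm_ae ?_
    filter_upwards [hle] with a ha
    simpa only [enorm_eq_self] using mul_le_mul_left ha _

theorem eLpNorm_ennreal_mul_le {p q r : ℝ≥0∞} [hpqr : ENNReal.HolderTriple p q r]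
    (hp : p ≠ 0) (hq : q ≠ 0) {f g : α → ℝ≥0∞}
    (hf : AEMeasurable f μ) (hg : AEMeasurable g μ) :
    eLpNorm (fun a => f a * g a) r μ ≤ eLpNorm f p μ * eLpNorm g q μ := by
  rcases eq_or_ne p ∞ with rfl | hp'
  · obtain rfl : r = q := ENNReal.HolderTriple.unique ∞ q r q
    exact eLpNorm_ennreal_mul_le_top_mul r f hg
  rcases eq_or_ne q ∞ with rfl | hq'
  · obtain rfl : r = p := ENNReal.HolderTriple.unique p ∞ r p
    simpa only [mul_comm] using eLpNorm_ennreal_mul_le_top_mul r g hf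
  have hp0 := ENNReal.toReal_pos hp hp'
  have hq0 := ENNReal.toReal_pos hq hq'
  have h := ENNReal.HolderTriple.toReal hp0 hq0 (r := r)
  obtain ⟨hr, hr'⟩ := ENNReal.toReal_pos_iff.mp h.pos'
  rw [eLpNorm_ennreal_eq hr.ne' hr'.ne, eLpNorm_ennreal_eq hp hp', eLpNorm_ennreal_eq hq hq']
  exact ENNReal.lintegral_Lp_mul_le_Lq_mul_Lr h.pos' h.lt h.one_div_eq μ hf hg

end Lp

section EllNorm

variable {ι : Type*}

theorem ellNorm_eq_eLpNorm {r : ℝ≥0∞} (hr : r ≠ 0) (a : ι → ℝ≥0∞) :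
    ellNorm r a = @eLpNorm ι ℝ≥0∞ _ ⊤ a r (@Measure.count ι ⊤) := by
  let _ : MeasurableSpace ι := ⊤
  rw [ellNorm]
  split_ifs with h
  · simp [h, eLpNorm_exponent_top]
  · rw [eLpNorm_ennreal_eq hr h, lintegral_count]

@[gcongr]
theorem ellNorm_mono {r : ℝ≥0∞} {a b : ι → ℝ≥0∞} (h : ∀ k, a k ≤ b k) :
    ellNorm r a ≤ ellNorm r b := by
  rw [ellNorm, ellNorm]
  split_ifs
  · exact iSup_mono h
  · gcongr
    exact h _

theorem ellNorm_comp_le_of_injective {κ : Type*} {φ : κ → ι} (hφ : φ.Injective) {r : ℝ≥0∞}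
    (a : ι → ℝ≥0∞) : ellNorm r (fun k => a (φ k)) ≤ ellNorm r a := by
  rw [ellNorm, ellNorm]
  split_ifs
  · exact iSup_comp_le a φ
  · gcongr
    exact ENNReal.tsum_comp_le_tsum_of_injective hφ _

theorem ellNorm_add_le {r : ℝ≥0∞} (hr : 1 ≤ r) (a b : ι → ℝ≥0∞) :
    ellNorm r (fun k => a k + b k) ≤ ellNorm r a + ellNorm r b := by
  let _ : MeasurableSpace ι := ⊤
  simp only [ellNorm_eq_eLpNorm (one_pos.trans_le hr).ne']
  exact eLpNorm_ennreal_add_le hr a measurable_from_top.aemeasurable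

theorem ellNorm_const_mul {r : ℝ≥0∞} (hr : r ≠ 0) (c : ℝ≥0) (a : ι → ℝ≥0∞) :
    ellNorm r (fun k => c * a k) = c * ellNorm r a := by
  let _ : MeasurableSpace ι := ⊤
  simp only [ellNorm_eq_eLpNorm hr]
  exact eLpNorm_ennreal_const_mul r c a

theorem ellNorm_zero {r : ℝ≥0∞} (hr : r ≠ 0) : ellNorm r (fun _ : ι => 0) = 0 := by
  simpa using ellNorm_const_mul hr 0 (fun _ : ι => 0)

theorem ellNorm_mul_le {p q r : ℝ≥0∞} [ENNReal.HolderTriple p q r] (hp : p ≠ 0) (hq : q ≠ 0)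
    (hr : r ≠ 0) (a b : ι → ℝ≥0∞) :
    ellNorm r (fun k => a k * b k) ≤ ellNorm p a * ellNorm q b := by
  let _ : MeasurableSpace ι := ⊤
  simp only [ellNorm_eq_eLpNorm hr, ellNorm_eq_eLpNorm hp, ellNorm_eq_eLpNorm hq]
  exact eLpNorm_ennreal_mul_le hp hq measurable_from_top.aemeasurable
    measurable_from_top.aemeasurable

theorem ellNorm_sum_le {κ : Type*} {r : ℝ≥0∞} (hr : 1 ≤ r) (s : Finset κ) (a : κ → ι → ℝ≥0∞) :
    ellNorm r (fun k => ∑ j ∈ s, a j k) ≤ ∑ j ∈ s, ellNorm r (a j) := by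
  let _ : MeasurableSpace ι := ⊤
  simp only [ellNorm_eq_eLpNorm (one_pos.trans_le hr).ne']
  exact eLpNorm_ennreal_sum_le hr s fun _ _ => measurable_from_top.aemeasurable

theorem ellNorm_rpow [Fintype ι] {r : ℝ≥0∞} (hr : r ≠ 0) (hr' : r ≠ ∞) (a : ι → ℝ≥0∞) :
    ellNorm r a ^ r.toReal = ∑ k, a k ^ r.toReal := by
  have := ENNReal.toReal_pos hr hr'
  rw [ellNorm, if_neg hr', ← ENNReal.rpow_mul, one_div_mul_cancel this.ne', ENNReal.rpow_one,
    tsum_fintype]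

theorem ellNorm_unique [Unique ι] {r : ℝ≥0∞} (hr : r ≠ 0) (a : ι → ℝ≥0∞) :
    ellNorm r a = a default := by
  rw [ellNorm]
  split_ifs with h
  · simp
  · rw [tsum_fintype, Fintype.sum_unique, one_div,
      ENNReal.rpow_rpow_inv (ENNReal.toReal_pos hr h).ne']

theorem le_ellNorm {r : ℝ≥0∞} (hr : r ≠ 0) (a : ι → ℝ≥0∞) (k : ι) : a k ≤ ellNorm r a :=
  calc a k = ellNorm r fun _ : Unit => a k :=
      (ellNorm_unique hr fun _ : Unit => a k).symm
    _ ≤ ellNorm r a := ellNorm_comp_le_of_injective (φ := fun _ : Unit => k)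
      (Function.injective_of_subsingleton _) a

theorem ellNorm_ne_top [Finite ι] {r : ℝ≥0∞} {a : ι → ℝ≥0∞} (h : ∀ k, a k ≠ ∞) :
    ellNorm r a ≠ ∞ := by
  have := Fintype.ofFinite ι
  rw [ellNorm]
  split_ifs
  · rw [← Finset.sup_univ_eq_iSup]
    exact ((Finset.sup_lt_iff ENNReal.zero_lt_top).2 fun k _ => (h k).lt_top).ne
  · rw [tsum_fintype]
    refine ENNReal.rpow_ne_top_of_nonneg (by positivity) (ENNReal.sum_ne_top.2 fun k _ => ?_)
    exact ENNReal.rpow_ne_top_of_nonneg (by positivity) (h k)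

theorem measurable_ellNorm [Countable ι] {Ω : Type*} {_ : MeasurableSpace Ω} {r : ℝ≥0∞}
    {a : ι → Ω → ℝ≥0∞} (h : ∀ k, Measurable (a k)) :
    Measurable (fun ω => ellNorm r fun k => a k ω) := by
  simp only [ellNorm]
  split_ifs
  · exact Measurable.iSup h
  · exact (Measurable.tsum fun k => (h k).pow_const _).pow_const _

end EllNorm

section FiniteHorizon

/-- The square function `(∑_{j < n} |d_j|²)^{1/2}` of a sequence of increments, where `d_j` is the
increment between the times `j` and `j + 1`. -/
noncomputable def squareFn (d : ℕ → ℝ) (n : ℕ) : ℝ≥0∞ :=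
  (∑ j ∈ Finset.range n, ‖d j‖ₑ ^ (2 : ℝ)) ^ (1 / 2 : ℝ)

/-- The maximal function `max_{m ≤ n} |∑_{j < m} d_j|` of a sequence of increments. -/
noncomputable def maxPartialSum (d : ℕ → ℝ) (n : ℕ) : ℝ≥0∞ :=
  (Finset.range (n + 1)).sup fun m => ‖∑ j ∈ Finset.range m, d j‖ₑ

/-- The maximal function `max_{j < n} |f_j|` of a process up to time `n`. -/
noncomputable def maxAbs (f : ℕ → ℝ) (n : ℕ) : ℝ≥0∞ :=
  (Finset.range n).sup fun j => ‖f j‖ₑ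

theorem squareFn_eq_zero {d : ℕ → ℝ} {n : ℕ} (h : ∀ j < n, d j = 0) : squareFn d n = 0 := by
  rw [squareFn, Finset.sum_eq_zero fun j hj => by simp [h j (Finset.mem_range.1 hj)]]
  simp

theorem squareFn_succ_le (d : ℕ → ℝ) (n : ℕ) : squareFn d (n + 1) ≤ squareFn d n + ‖d n‖ₑ := by
  rw [squareFn, Finset.sum_range_succ]
  refine (ENNReal.rpow_add_le_add_rpow _ _ (by norm_num) (by norm_num)).trans ?_
  rw [← ENNReal.rpow_mul]
  norm_num [squareFn]

theorem squareFn_le_sum (d : ℕ → ℝ) (n : ℕ) : squareFn d n ≤ ∑ j ∈ Finset.range n, ‖d j‖ₑ := by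
  induction n with
  | zero => simp [squareFn]
  | succ n ih =>
    rw [Finset.sum_range_succ]
    exact (squareFn_succ_le d n).trans (by gcongr)

theorem squareFn_mono (d : ℕ → ℝ) : Monotone (squareFn d) := by
  intro m n h
  rw [squareFn, squareFn]
  gcongr

theorem squareFn_mono_left {d e : ℕ → ℝ} {n : ℕ} (h : ∀ j < n, ‖d j‖ₑ ≤ ‖e j‖ₑ) :
    squareFn d n ≤ squareFn e n := by
  rw [squareFn, squareFn]
  gcongr with j hj
  exact h j (Finset.mem_range.1 hj)

theorem enorm_le_squareFn (d : ℕ → ℝ) {j n : ℕ} (h : j < n) : ‖d j‖ₑ ≤ squareFn d n := by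
  calc ‖d j‖ₑ = (‖d j‖ₑ ^ (2 : ℝ)) ^ (1 / 2 : ℝ) := by
        rw [one_div, ENNReal.rpow_rpow_inv two_ne_zero]
    _ ≤ squareFn d n := by
        rw [squareFn]
        gcongr
        exact Finset.single_le_sum (f := fun j => ‖d j‖ₑ ^ (2 : ℝ)) (fun _ _ => zero_le)
          (Finset.mem_range.2 h)

theorem squareFn_add_le (d e : ℕ → ℝ) (n : ℕ) :
    squareFn (fun j => d j + e j) n ≤ squareFn d n + squareFn e n := by
  refine le_trans ?_ (ENNReal.Lp_add_le (Finset.range n) (fun j => ‖d j‖ₑ) (fun j => ‖e j‖ₑ)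
    one_le_two)
  rw [squareFn]
  gcongr
  exact enorm_add_le _ _

theorem enorm_le_maxAbs (f : ℕ → ℝ) {j n : ℕ} (h : j < n) : ‖f j‖ₑ ≤ maxAbs f n :=
  Finset.le_sup (f := fun j => ‖f j‖ₑ) (Finset.mem_range.2 h)

theorem maxAbs_mono (f : ℕ → ℝ) : Monotone (maxAbs f) := fun _ _ h =>
  Finset.sup_mono (Finset.range_mono h)

theorem squareFn_mul_le (f d : ℕ → ℝ) (n : ℕ) :
    squareFn (fun j => f j * d j) n ≤ maxAbs f n * squareFn d n := by
  calc squareFn (fun j => f j * d j) n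
      ≤ (∑ j ∈ Finset.range n, maxAbs f n ^ (2 : ℝ) * ‖d j‖ₑ ^ (2 : ℝ)) ^ (1 / 2 : ℝ) := by
        rw [squareFn]
        gcongr with j hj
        rw [enorm_mul, ENNReal.mul_rpow_of_nonneg _ _ zero_le_two]
        gcongr
        exact enorm_le_maxAbs f (Finset.mem_range.1 hj)
    _ = maxAbs f n * squareFn d n := by
        rw [← Finset.mul_sum, ENNReal.mul_rpow_of_nonneg _ _ one_half_pos.le, one_div,
          ENNReal.rpow_rpow_inv two_ne_zero, squareFn, one_div]

theorem enorm_sum_le_maxPartialSum (d : ℕ → ℝ) {m n : ℕ} (h : m ≤ n) :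
    ‖∑ j ∈ Finset.range m, d j‖ₑ ≤ maxPartialSum d n :=
  Finset.le_sup (f := fun m => ‖∑ j ∈ Finset.range m, d j‖ₑ)
    (Finset.mem_range.2 (Nat.lt_succ_of_le h))

theorem maxPartialSum_le {d : ℕ → ℝ} {n : ℕ} {c : ℝ≥0∞}
    (h : ∀ m ≤ n, ‖∑ j ∈ Finset.range m, d j‖ₑ ≤ c) : maxPartialSum d n ≤ c :=
  Finset.sup_le fun m hm => h m (Nat.lt_succ_iff.1 (Finset.mem_range.1 hm))

theorem maxPartialSum_le_sum (d : ℕ → ℝ) (n : ℕ) :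
    maxPartialSum d n ≤ ∑ j ∈ Finset.range n, ‖d j‖ₑ :=
  maxPartialSum_le fun m hm => (enorm_sum_le _ _).trans (by gcongr)

theorem maxPartialSum_mono (d : ℕ → ℝ) : Monotone (maxPartialSum d) := fun _ _ h =>
  maxPartialSum_le fun _ hm => enorm_sum_le_maxPartialSum d (hm.trans h)

theorem maxPartialSum_add_le (d e : ℕ → ℝ) (n : ℕ) :
    maxPartialSum (fun j => d j + e j) n ≤ maxPartialSum d n + maxPartialSum e n := by
  refine maxPartialSum_le fun m hm => ?_
  rw [Finset.sum_add_distrib]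
  exact (enorm_add_le _ _).trans
    (add_le_add (enorm_sum_le_maxPartialSum d hm) (enorm_sum_le_maxPartialSum e hm))

theorem sum_enorm_ne_top (d : ℕ → ℝ) (n : ℕ) : ∑ j ∈ Finset.range n, ‖d j‖ₑ ≠ ∞ :=
  ENNReal.sum_ne_top.2 fun _ _ => enorm_ne_top

theorem maxPartialSum_ne_top (d : ℕ → ℝ) (n : ℕ) : maxPartialSum d n ≠ ∞ :=
  ne_top_of_le_ne_top (sum_enorm_ne_top d n) (maxPartialSum_le_sum d n)

theorem squareFn_ne_top (d : ℕ → ℝ) (n : ℕ) : squareFn d n ≠ ∞ :=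
  ne_top_of_le_ne_top (sum_enorm_ne_top d n) (squareFn_le_sum d n)

theorem maxAbs_ne_top (f : ℕ → ℝ) (n : ℕ) : maxAbs f n ≠ ∞ :=
  ne_top_of_le_ne_top (sum_enorm_ne_top f n)
    (Finset.sup_le fun _ hj => Finset.single_le_sum_of_canonicallyOrdered (f := fun j => ‖f j‖ₑ) hj)

variable {Ω : Type*} {m : MeasurableSpace Ω}

theorem measurable_squareFn {d : ℕ → Ω → ℝ} {n : ℕ} (h : ∀ j < n, Measurable (d j)) :
    Measurable fun ω => squareFn (fun j => d j ω) n :=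
  (Finset.measurable_sum _ fun j hj =>
    (h j (Finset.mem_range.1 hj)).enorm.pow_const _).pow_const _

theorem measurable_maxPartialSum {d : ℕ → Ω → ℝ} {n : ℕ} (h : ∀ j < n, Measurable (d j)) :
    Measurable fun ω => maxPartialSum (fun j => d j ω) n := by
  simp only [maxPartialSum, Finset.sup_eq_iSup, Finset.mem_range, Nat.lt_succ_iff]
  exact Measurable.iSup fun k => Measurable.iSup fun hk =>
    (Finset.measurable_sum _ fun j hj => h j ((Finset.mem_range.1 hj).trans_le hk)).enorm

theorem measurable_maxAbs {f : ℕ → Ω → ℝ} {n : ℕ} (h : ∀ j < n, Measurable (f j)) :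
    Measurable fun ω => maxAbs (fun j => f j ω) n := by
  simp only [maxAbs, Finset.sup_eq_iSup, Finset.mem_range]
  exact Measurable.iSup fun j => Measurable.iSup fun hj => (h j hj).enorm

end FiniteHorizon

section MartingaleDifferences

variable {Ω : Type*} {m : MeasurableSpace Ω} {ℱ : Filtration ℕ m} {P : Measure Ω}
  {d : ℕ → Ω → ℝ}

/-- A martingale difference sequence: `d j` is the increment from time `j` to time `j + 1`. -/
structure IsMartingaleDiff (ℱ : Filtration ℕ m) (P : Measure Ω) (d : ℕ → Ω → ℝ) : Prop where
  measurable_succ : ∀ j, Measurable[ℱ (j + 1)] (d j)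
  integrable : ∀ j, Integrable (d j) P
  condExp_eq_zero : ∀ j, P[d j | ℱ j] =ᵐ[P] 0

/-- A sequence of increments whose restrictions to predictable sets are martingale differences as
soon as they are integrable. Transforms of martingale differences by arbitrary adapted processes
have this property, without any integrability assumption. -/
structure IsLocalMartingaleDiff (ℱ : Filtration ℕ m) (P : Measure Ω) (d : ℕ → Ω → ℝ) : Prop where
  measurable_succ : ∀ j, Measurable[ℱ (j + 1)] (d j)
  condExp_indicator_eq_zero : ∀ j A, MeasurableSet[ℱ j] A →
    Integrable (A.indicator (d j)) P → P[A.indicator (d j) | ℱ j] =ᵐ[P] 0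

theorem measurable_partialSum (hd : ∀ j, Measurable[ℱ (j + 1)] (d j)) (n : ℕ) :
    Measurable[ℱ n] fun ω => ∑ j ∈ Finset.range n, d j ω :=
  Finset.measurable_sum (m := ℱ n) _ fun j hj =>
    (hd j).mono (ℱ.mono (Finset.mem_range.1 hj)) le_rfl

theorem adapted_maxPartialSum (hd : ∀ j, Measurable[ℱ (j + 1)] (d j)) :
    Adapted ℱ fun n ω => maxPartialSum (fun j => d j ω) n := fun n =>
  measurable_maxPartialSum (m := ℱ n) fun j hj => (hd j).mono (ℱ.mono hj) le_rfl

namespace IsLocalMartingaleDiff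

theorem measurable (hd : IsLocalMartingaleDiff ℱ P d) (j : ℕ) : Measurable (d j) :=
  (hd.measurable_succ j).mono (ℱ.le _) le_rfl

theorem indicator (hd : IsLocalMartingaleDiff ℱ P d) {A : ℕ → Set Ω}
    (hA : ∀ j, MeasurableSet[ℱ j] (A j)) (hint : ∀ j, Integrable ((A j).indicator (d j)) P) :
    IsMartingaleDiff ℱ P fun j => (A j).indicator (d j) where
  measurable_succ j := (hd.measurable_succ j).indicator (ℱ.mono j.le_succ _ (hA j))
  integrable := hint
  condExp_eq_zero j := hd.condExp_indicator_eq_zero j _ (hA j) (hint j)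

end IsLocalMartingaleDiff

namespace IsMartingaleDiff

theorem measurable (hd : IsMartingaleDiff ℱ P d) (j : ℕ) : Measurable (d j) :=
  (hd.measurable_succ j).mono (ℱ.le _) le_rfl

theorem isLocalMartingaleDiff_mul (hd : IsMartingaleDiff ℱ P d) {f : ℕ → Ω → ℝ}
    (hf : Adapted ℱ f) : IsLocalMartingaleDiff ℱ P fun j ω => f j ω * d j ω where
  measurable_succ j := ((hf j).mono (ℱ.mono j.le_succ) le_rfl).mul (hd.measurable_succ j)
  condExp_indicator_eq_zero j A hA hint := by
    have hmul : A.indicator (fun ω => f j ω * d j ω) = A.indicator (f j) * d j :=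
      funext fun _ => Set.indicator_mul_left A (f j) (d j)
    rw [hmul] at hint ⊢
    filter_upwards [condExp_mul_of_stronglyMeasurable_left
      ((hf j).indicator hA).stronglyMeasurable hint (hd.integrable j), hd.condExp_eq_zero j]
      with ω hω hzero
    simp [hω, hzero]

theorem indicator (hd : IsMartingaleDiff ℱ P d) {A : ℕ → Set Ω}
    (hA : ∀ j, MeasurableSet[ℱ j] (A j)) :
    IsMartingaleDiff ℱ P fun j => (A j).indicator (d j) := by
  have hlocal := hd.isLocalMartingaleDiff_mul (f := fun _ _ => 1) fun _ => measurable_const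
  simp only [one_mul] at hlocal
  exact hlocal.indicator hA fun j => (hd.integrable j).indicator (ℱ.le j _ (hA j))

variable [IsFiniteMeasure P]

theorem integral_partialSum_mul_eq_zero (hd : IsMartingaleDiff ℱ P d)
    (hd2 : ∀ j, MemLp (d j) 2 P) (n : ℕ) :
    ∫ ω, (∑ j ∈ Finset.range n, d j ω) * d n ω ∂P = 0 := by
  have hint : Integrable (fun ω => (∑ j ∈ Finset.range n, d j ω) * d n ω) P :=
    (memLp_finsetSum _ fun j _ => hd2 j).integrable_mul (hd2 n)
  rw [← integral_condExp (ℱ.le n)]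
  refine integral_eq_zero_of_ae ?_
  filter_upwards [condExp_mul_of_stronglyMeasurable_left
    (measurable_partialSum hd.measurable_succ n).stronglyMeasurable hint (hd.integrable n),
    hd.condExp_eq_zero n] with ω hω hzero
  exact hω.trans (by simp [hzero])

theorem integral_partialSum_sq (hd : IsMartingaleDiff ℱ P d) (hd2 : ∀ j, MemLp (d j) 2 P)
    (n : ℕ) :
    ∫ ω, (∑ j ∈ Finset.range n, d j ω) ^ 2 ∂P = ∫ ω, ∑ j ∈ Finset.range n, d j ω ^ 2 ∂P := by
  have hsum2 : ∀ n, MemLp (fun ω => ∑ j ∈ Finset.range n, d j ω) 2 P := fun n =>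
    memLp_finsetSum _ fun j _ => hd2 j
  induction n with
  | zero => simp
  | succ n ih =>
    have hcross : Integrable (fun ω => 2 * ((∑ j ∈ Finset.range n, d j ω) * d n ω)) P :=
      ((hsum2 n).integrable_mul (hd2 n)).const_mul 2
    have hrest : Integrable
        (fun ω => 2 * ((∑ j ∈ Finset.range n, d j ω) * d n ω) + d n ω ^ 2) P :=
      hcross.add (hd2 n).integrable_sq
    calc ∫ ω, (∑ j ∈ Finset.range (n + 1), d j ω) ^ 2 ∂P
        = ∫ ω, (∑ j ∈ Finset.range n, d j ω) ^ 2
            + (2 * ((∑ j ∈ Finset.range n, d j ω) * d n ω) + d n ω ^ 2) ∂P := by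
          refine integral_congr_ae (.of_forall fun ω => ?_)
          simp only [Finset.sum_range_succ]
          ring
      _ = ∫ ω, ∑ j ∈ Finset.range n, d j ω ^ 2 ∂P + ∫ ω, d n ω ^ 2 ∂P := by
          rw [integral_add (hsum2 n).integrable_sq hrest,
            integral_add hcross (hd2 n).integrable_sq, integral_const_mul,
            hd.integral_partialSum_mul_eq_zero hd2, mul_zero, zero_add, ih]
      _ = ∫ ω, ∑ j ∈ Finset.range (n + 1), d j ω ^ 2 ∂P := by
          simp only [Finset.sum_range_succ]
          rw [integral_add (integrable_finsetSum _ fun j _ => (hd2 j).integrable_sq)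
            (hd2 n).integrable_sq]

theorem lintegral_partialSum_sq (hd : IsMartingaleDiff ℱ P d) (hd2 : ∀ j, MemLp (d j) 2 P)
    (n : ℕ) :
    ∫⁻ ω, ‖∑ j ∈ Finset.range n, d j ω‖ₑ ^ (2 : ℝ) ∂P
      = ∫⁻ ω, squareFn (fun j => d j ω) n ^ (2 : ℝ) ∂P := by
  have henorm : ∀ x : ℝ, ‖x‖ₑ ^ (2 : ℝ) = ENNReal.ofReal (x ^ 2) := fun x => by
    rw [Real.enorm_eq_ofReal_abs, ENNReal.rpow_two, ← ENNReal.ofReal_pow (abs_nonneg x), sq_abs]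
  simp only [squareFn, one_div, ENNReal.rpow_inv_rpow two_ne_zero, henorm]
  simp only [← ENNReal.ofReal_sum_of_nonneg fun _ _ => sq_nonneg _]
  rw [← ofReal_integral_eq_lintegral_ofReal (memLp_finsetSum _ fun j _ => hd2 j).integrable_sq
      (.of_forall fun _ => sq_nonneg _),
    ← ofReal_integral_eq_lintegral_ofReal
      (integrable_finsetSum _ fun j _ => (hd2 j).integrable_sq)
      (.of_forall fun _ => Finset.sum_nonneg fun _ _ => sq_nonneg _),
    hd.integral_partialSum_sq hd2]

end IsMartingaleDiff

theorem exists_crossing_time {α : Type*} [LinearOrder α] {f : ℕ → α} (hf : Monotone f) {l : α}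
    {n : ℕ} (h : l < f n) : ∃ k ≤ n, ∀ j, f j ≤ l ↔ j < k := by
  classical
  have hex : ∃ k, l < f k := ⟨n, h⟩
  exact ⟨Nat.find hex, Nat.find_min' hex h, fun j =>
    ⟨fun hj => lt_of_not_ge fun hk => ((Nat.find_spec hex).trans_le (hf hk)).not_ge hj,
      fun hj => not_lt.1 (Nat.find_min hex hj)⟩⟩

theorem exists_maxPartialSum_crossing {d : ℕ → ℝ} {n : ℕ} {l : ℝ≥0∞}
    (h : l < maxPartialSum d n) :
    ∃ k ≤ n, (∀ j, maxPartialSum d j ≤ l ↔ j < k) ∧ l < ‖∑ j ∈ Finset.range k, d j‖ₑ := by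
  obtain ⟨k, hkn, hk⟩ := exists_crossing_time (maxPartialSum_mono d) h
  refine ⟨k, hkn, hk, ?_⟩
  obtain ⟨i, hi, hlt⟩ := Finset.lt_sup_iff.1 (not_le.1 fun hle => lt_irrefl k ((hk k).1 hle))
  have hki : k ≤ i := not_lt.1 fun hik =>
    (hlt.trans_le (enorm_sum_le_maxPartialSum d le_rfl)).not_ge ((hk i).2 hik)
  rwa [← le_antisymm (Nat.lt_succ_iff.1 (Finset.mem_range.1 hi)) hki]

theorem lt_enorm_stopped_sum {d : ℕ → Ω → ℝ} {n : ℕ} {l : ℝ≥0∞} {ω : Ω}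
    (h : l < maxPartialSum (fun j => d j ω) n) :
    l < ‖∑ j ∈ Finset.range n,
      {ω | maxPartialSum (fun i => d i ω) j ≤ l}.indicator (d j) ω‖ₑ := by
  classical
  obtain ⟨k, hkn, hcross, hlt⟩ := exists_maxPartialSum_crossing h
  have hfilter : (Finset.range n).filter (· < k) = Finset.range k := by
    ext j
    simpa using fun hj : j < k => hj.trans_le hkn
  simpa only [Set.indicator_apply, Set.mem_ofPred_eq, hcross, ← Finset.sum_filter, hfilter]
    using hlt

theorem IsMartingaleDiff.weak_type_two [IsFiniteMeasure P] (hd : IsMartingaleDiff ℱ P d)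
    (hd2 : ∀ j, MemLp (d j) 2 P) (n : ℕ) (l : ℝ≥0∞) :
    l ^ (2 : ℝ) * P {ω | l < maxPartialSum (fun j => d j ω) n}
      ≤ ∫⁻ ω, squareFn (fun j => d j ω) n ^ (2 : ℝ) ∂P := by
  let A : ℕ → Set Ω := fun j => {ω | maxPartialSum (fun i => d i ω) j ≤ l}
  have hA : ∀ j, MeasurableSet[ℱ j] (A j) := fun j =>
    adapted_maxPartialSum hd.measurable_succ j measurableSet_Iic
  have hstopped2 : ∀ j, MemLp ((A j).indicator (d j)) 2 P := fun j =>
    (hd2 j).indicator (ℱ.le j _ (hA j))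
  calc l ^ (2 : ℝ) * P {ω | l < maxPartialSum (fun j => d j ω) n}
      ≤ l ^ (2 : ℝ) * P {ω | l ^ (2 : ℝ)
          ≤ ‖∑ j ∈ Finset.range n, (A j).indicator (d j) ω‖ₑ ^ (2 : ℝ)} := by
        gcongr with ω
        exact fun hω => ENNReal.rpow_le_rpow (lt_enorm_stopped_sum hω).le zero_le_two
    _ ≤ ∫⁻ ω, ‖∑ j ∈ Finset.range n, (A j).indicator (d j) ω‖ₑ ^ (2 : ℝ) ∂P :=
        mul_meas_ge_le_lintegral₀ ((Finset.aemeasurable_fun_sum _ fun j _ =>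
          (hstopped2 j).aestronglyMeasurable.aemeasurable).enorm.pow_const _) _
    _ = ∫⁻ ω, squareFn (fun j => (A j).indicator (d j) ω) n ^ (2 : ℝ) ∂P :=
        (hd.indicator hA).lintegral_partialSum_sq hstopped2 n
    _ ≤ ∫⁻ ω, squareFn (fun j => d j ω) n ^ (2 : ℝ) ∂P := by
        gcongr with ω
        exact squareFn_mono_left fun j _ => enorm_indicator_le_enorm_self _ _

end MartingaleDifferences

section VectorValued

variable {Ω ι : Type*} {m : MeasurableSpace Ω} {ℱ : Filtration ℕ m} {P : Measure Ω} {r : ℝ≥0∞}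
  {d : ι → ℕ → Ω → ℝ}

/-- The `ℓ^r` norm of the square functions at time `n` of a family of sequences of increments. -/
noncomputable def ellSquareFn (r : ℝ≥0∞) (d : ι → ℕ → Ω → ℝ) (n : ℕ) (ω : Ω) : ℝ≥0∞ :=
  ellNorm r fun k => squareFn (fun j => d k j ω) n

/-- The `ℓ^r` norm of the maximal functions at time `n` of a family of sequences of increments. -/
noncomputable def ellMaxSum (r : ℝ≥0∞) (d : ι → ℕ → Ω → ℝ) (n : ℕ) (ω : Ω) : ℝ≥0∞ :=
  ellNorm r fun k => maxPartialSum (fun j => d k j ω) n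

theorem ellSquareFn_mono (r : ℝ≥0∞) (d : ι → ℕ → Ω → ℝ) (ω : Ω) :
    Monotone fun n => ellSquareFn r d n ω := fun _ _ h => ellNorm_mono fun _ => squareFn_mono _ h

theorem ellMaxSum_mono (r : ℝ≥0∞) (d : ι → ℕ → Ω → ℝ) (ω : Ω) :
    Monotone fun n => ellMaxSum r d n ω := fun _ _ h => ellNorm_mono fun _ => maxPartialSum_mono _ h

theorem ellSquareFn_succ_le (hr : 1 ≤ r) (d : ι → ℕ → Ω → ℝ) (n : ℕ) (ω : Ω) :
    ellSquareFn r d (n + 1) ω ≤ ellSquareFn r d n ω + ellNorm r fun k => ‖d k n ω‖ₑ :=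
  (ellNorm_mono fun _ => squareFn_succ_le _ n).trans (ellNorm_add_le hr _ _)

theorem ellSquareFn_le_add_sum_sub (hr : 1 ≤ r) (d e : ι → ℕ → Ω → ℝ) (n : ℕ) (ω : Ω) :
    ellSquareFn r d n ω
      ≤ ellSquareFn r e n ω + ∑ j ∈ Finset.range n, ellNorm r fun k => ‖e k j ω - d k j ω‖ₑ := by
  refine le_trans (ellNorm_mono fun k => ?_) <| (ellNorm_add_le hr _ _).trans <|
    add_le_add le_rfl (ellNorm_sum_le hr (Finset.range n) fun j k => ‖e k j ω - d k j ω‖ₑ)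
  have hsplit := squareFn_add_le (fun j => e k j ω) (fun j => d k j ω - e k j ω) n
  simp only [add_sub_cancel] at hsplit
  refine hsplit.trans (add_le_add le_rfl ((squareFn_le_sum _ n).trans_eq ?_))
  exact Finset.sum_congr rfl fun j _ => by rw [← enorm_neg, neg_sub]

theorem ellMaxSum_add_le (hr : 1 ≤ r) (d e : ι → ℕ → Ω → ℝ) (n : ℕ) (ω : Ω) :
    ellMaxSum r (d + e) n ω ≤ ellMaxSum r d n ω + ellMaxSum r e n ω :=
  (ellNorm_mono fun _ => maxPartialSum_add_le _ _ n).trans (ellNorm_add_le hr _ _)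

theorem ellMaxSum_ne_top [Finite ι] (n : ℕ) (ω : Ω) : ellMaxSum r d n ω ≠ ∞ :=
  ellNorm_ne_top fun _ => maxPartialSum_ne_top _ _

theorem measurable_ellSquareFn [Countable ι] {n : ℕ} (h : ∀ k, ∀ j < n, Measurable (d k j)) :
    Measurable (ellSquareFn r d n) :=
  measurable_ellNorm fun k => measurable_squareFn (h k)

theorem measurable_ellMaxSum [Countable ι] {n : ℕ} (h : ∀ k, ∀ j < n, Measurable (d k j)) :
    Measurable (ellMaxSum r d n) :=
  measurable_ellNorm fun k => measurable_maxPartialSum (h k)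

theorem adapted_ellMaxSum [Countable ι] (hd : ∀ k j, Measurable[ℱ (j + 1)] (d k j)) :
    Adapted ℱ (ellMaxSum r d) := fun n =>
  measurable_ellMaxSum (m := ℱ n) fun k j hj => (hd k j).mono (ℱ.mono hj) le_rfl

/-- The weak type `(r, r)` form of the Burkholder–Davis–Gundy inequality for `ℓ^r`-valued
martingales on a given filtered space. -/
def WeakTypeBDG (ℱ : Filtration ℕ m) (P : Measure Ω) (ι : Type*) (r : ℝ≥0∞) (C : ℝ≥0) : Prop :=
  ∀ d : ι → ℕ → Ω → ℝ, (∀ k, IsMartingaleDiff ℱ P (d k)) → (∀ k j, MemLp (d k j) ∞ P) →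
    ∀ (n : ℕ) (l : ℝ≥0), (l : ℝ≥0∞) ^ r.toReal * P {ω | l < ellMaxSum r d n ω}
      ≤ C * ∫⁻ ω, ellSquareFn r d n ω ^ r.toReal ∂P

theorem weakTypeBDG_two_unit [IsFiniteMeasure P] : WeakTypeBDG ℱ P Unit 2 1 := by
  intro d hd hbdd n l
  have h := (hd ()).weak_type_two (fun j => (hbdd () j).mono_exponent le_top) n l
  simpa [ellNorm_unique, ellMaxSum, ellSquareFn] using h

end VectorValued

section GoodLambda

variable {Ω : Type*} {m : MeasurableSpace Ω} {P : Measure Ω} {X V : Ω → ℝ≥0∞}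

theorem lintegral_div_rpow_eq_lintegral_meas_lt_mul (hX : Measurable X) (hX' : ∀ ω, X ω ≠ ∞)
    {c : ℝ≥0} (hc : c ≠ 0) {q : ℝ} (hq : 0 < q) :
    ∫⁻ ω, (X ω / c) ^ q ∂P = ENNReal.ofReal q * ∫⁻ t in Set.Ioi 0,
      P {ω | c * ENNReal.ofReal t < X ω} * ENNReal.ofReal (t ^ (q - 1)) := by
  have hne : ∀ ω, X ω / c ≠ ∞ := fun ω => ENNReal.div_ne_top (hX' ω) (by simpa using hc)
  have hrpow : ∀ ω, (X ω / c) ^ q = ENNReal.ofReal ((X ω / c).toReal ^ q) := fun ω => by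
    rw [← ENNReal.ofReal_rpow_of_nonneg ENNReal.toReal_nonneg hq.le, ENNReal.ofReal_toReal (hne ω)]
  simp only [hrpow]
  rw [lintegral_rpow_eq_lintegral_meas_lt_mul P (.of_forall fun _ => ENNReal.toReal_nonneg)
    (hX.div_const _).ennreal_toReal.aemeasurable hq]
  congr 1
  refine setLIntegral_congr_fun measurableSet_Ioi fun t (ht : 0 < t) => ?_
  have hlevel : ∀ ω, t < (X ω / c).toReal ↔ c * ENNReal.ofReal t < X ω := fun ω => by
    rw [← ENNReal.ofReal_lt_iff_lt_toReal ht.le (hne ω), mul_comm,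
      ENNReal.lt_div_iff_mul_lt (.inl (by simpa using hc)) (.inl ENNReal.coe_ne_top)]
  simp only [hlevel]

theorem lintegral_div_rpow_le_of_good_lambda (hX : Measurable X) (hV : Measurable V)
    (hX' : ∀ ω, X ω ≠ ∞) (hV' : ∀ ω, V ω ≠ ∞) {δ : ℝ≥0} (hδ : δ ≠ 0) {q : ℝ} (hq : 0 < q)
    {ε : ℝ≥0∞} (h : ∀ l : ℝ≥0, 0 < l →
      P {ω | 3 * l < X ω} ≤ P {ω | δ * l < V ω} + ε * P {ω | l < X ω}) :
    ∫⁻ ω, (X ω / 3) ^ q ∂P ≤ ∫⁻ ω, (V ω / δ) ^ q ∂P + ε * ∫⁻ ω, X ω ^ q ∂P := by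
  have hmeas : ∀ (c : ℝ≥0) (Y : Ω → ℝ≥0∞), Measurable fun t : ℝ =>
      P {ω | c * ENNReal.ofReal t < Y ω} * ENNReal.ofReal (t ^ (q - 1)) := fun c Y => by
    have hanti : Antitone fun t : ℝ => P {ω | c * ENNReal.ofReal t < Y ω} := fun s t hst =>
      measure_mono fun ω hω =>
        (mul_le_mul' le_rfl (ENNReal.ofReal_le_ofReal hst)).trans_lt hω
    exact hanti.measurable.mul (by fun_prop)
  have hX3 := lintegral_div_rpow_eq_lintegral_meas_lt_mul (P := P) hX hX' three_ne_zero hq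
  have hX1 := lintegral_div_rpow_eq_lintegral_meas_lt_mul (P := P) hX hX' one_ne_zero hq
  simp only [ENNReal.coe_one, ENNReal.coe_ofNat, div_one] at hX3 hX1
  rw [hX3, hX1, lintegral_div_rpow_eq_lintegral_meas_lt_mul hV hV' hδ hq, mul_left_comm ε,
    ← mul_add, ← lintegral_const_mul ε (by simpa using hmeas 1 X),
    ← lintegral_add_left (hmeas δ V)]
  gcongr _ * ?_
  refine setLIntegral_mono' measurableSet_Ioi fun t ht => ?_
  rw [← mul_assoc, ← add_mul, one_mul]
  gcongr
  exact h t.toNNReal (Real.toNNReal_pos.2 ht)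

theorem le_two_mul_of_le_add_half {a b : ℝ≥0∞} (ha : a ≠ ∞) (h : a ≤ b + a / 2) : a ≤ 2 * b := by
  have hhalf : a / 2 ≤ b := by
    rw [← ENNReal.add_le_add_iff_right (ENNReal.div_ne_top ha two_ne_zero), ENNReal.add_halves]
    exact h
  calc a = 2 * (a / 2) := (ENNReal.mul_div_cancel two_ne_zero ENNReal.ofNat_ne_top).symm
    _ ≤ 2 * b := by gcongr

theorem lintegral_rpow_le_of_good_lambda_of_ne_top (hX : Measurable X) (hV : Measurable V)
    (hX' : ∀ ω, X ω ≠ ∞) (hV' : ∀ ω, V ω ≠ ∞) {δ : ℝ≥0} (hδ : δ ≠ 0) {q : ℝ} (hq : 0 < q)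
    (hI : ∫⁻ ω, X ω ^ q ∂P ≠ ∞) {ε : ℝ≥0∞} (hε : ε * 3 ^ q ≤ 2⁻¹) (h : ∀ l : ℝ≥0, 0 < l →
      P {ω | 3 * l < X ω} ≤ P {ω | δ * l < V ω} + ε * P {ω | l < X ω}) :
    ∫⁻ ω, X ω ^ q ∂P ≤ (2 * (3 / δ) ^ q : ℝ≥0) * ∫⁻ ω, V ω ^ q ∂P := by
  have hscale : ∀ (c : ℝ≥0∞) (Y : Ω → ℝ≥0∞), c ≠ 0 →
      ∫⁻ ω, (Y ω / c) ^ q ∂P = (c ^ q)⁻¹ * ∫⁻ ω, Y ω ^ q ∂P := fun c Y hc => by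
    rw [← lintegral_const_mul' _ _
      (ENNReal.inv_ne_top.2 (ENNReal.rpow_pos_of_nonneg (pos_iff_ne_zero.2 hc) hq.le).ne')]
    refine lintegral_congr fun ω => ?_
    rw [ENNReal.div_rpow_of_nonneg _ _ hq.le, ENNReal.div_eq_inv_mul]
  have hmain := lintegral_div_rpow_le_of_good_lambda hX hV hX' hV' hδ hq h
  rw [hscale 3 X three_ne_zero, hscale δ V (by simpa using hδ)] at hmain
  have h3 : (3 : ℝ≥0∞) ^ q ≠ 0 := (ENNReal.rpow_pos (by norm_num) (by norm_num)).ne'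
  have h3' : (3 : ℝ≥0∞) ^ q ≠ ∞ := ENNReal.rpow_ne_top_of_nonneg hq.le (by norm_num)
  set I := ∫⁻ ω, X ω ^ q ∂P
  set J := ∫⁻ ω, V ω ^ q ∂P
  have hhalf : I ≤ (3 ^ q * ((δ : ℝ≥0∞) ^ q)⁻¹) * J + I / 2 := by
    calc I = 3 ^ q * ((3 ^ q)⁻¹ * I) := by rw [← mul_assoc, ENNReal.mul_inv_cancel h3 h3', one_mul]
      _ ≤ 3 ^ q * (((δ : ℝ≥0∞) ^ q)⁻¹ * J + ε * I) := by gcongr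
      _ = (3 ^ q * ((δ : ℝ≥0∞) ^ q)⁻¹) * J + ε * 3 ^ q * I := by ring
      _ ≤ (3 ^ q * ((δ : ℝ≥0∞) ^ q)⁻¹) * J + I / 2 := by rw [ENNReal.div_eq_inv_mul]; gcongr
  have hconst : ((2 * (3 / δ) ^ q : ℝ≥0) : ℝ≥0∞) = 2 * (3 ^ q * ((δ : ℝ≥0∞) ^ q)⁻¹) := by
    rw [ENNReal.coe_mul, ENNReal.coe_rpow_of_nonneg _ hq.le, ENNReal.coe_div hδ,
      ENNReal.div_rpow_of_nonneg _ _ hq.le, ENNReal.div_eq_inv_mul, mul_comm (_⁻¹)]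
    rfl
  rw [hconst, mul_assoc]
  exact le_two_mul_of_le_add_half hI hhalf

theorem lintegral_rpow_le_of_good_lambda [IsFiniteMeasure P] (hX : Measurable X)
    (hV : Measurable V) (hX' : ∀ ω, X ω ≠ ∞) (hV' : ∀ ω, V ω ≠ ∞) {δ : ℝ≥0} (hδ : δ ≠ 0) {q : ℝ}
    (hq : 0 < q) {ε : ℝ≥0∞} (hε : ε * 3 ^ q ≤ 2⁻¹) (h : ∀ l : ℝ≥0, 0 < l →
      P {ω | 3 * l < X ω} ≤ P {ω | δ * l < V ω} + ε * P {ω | l < X ω}) :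
    ∫⁻ ω, X ω ^ q ∂P ≤ (2 * (3 / δ) ^ q : ℝ≥0) * ∫⁻ ω, V ω ^ q ∂P := by
  have htrunc : ∀ K : ℕ, ∫⁻ ω, min (X ω) K ^ q ∂P
      ≤ (2 * (3 / δ) ^ q : ℝ≥0) * ∫⁻ ω, V ω ^ q ∂P := fun K => by
    have hI : ∫⁻ ω, min (X ω) K ^ q ∂P ≠ ∞ := by
      refine ne_top_of_le_ne_top (b := ∫⁻ _, (K : ℝ≥0∞) ^ q ∂P) ?_
        (by gcongr; exact min_le_right ..)
      rw [lintegral_const]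
      finiteness
    refine lintegral_rpow_le_of_good_lambda_of_ne_top (hX.min measurable_const) hV
      (fun ω => ne_top_of_le_ne_top (hX' ω) (min_le_left ..)) hV' hδ hq hI hε fun l hl => ?_
    rcases lt_or_ge (3 * l : ℝ≥0∞) K with hK | hK
    · have hlK : (l : ℝ≥0∞) < K :=
        (le_mul_of_one_le_left zero_le (by norm_num)).trans_lt hK
      simpa only [lt_min_iff, hK, hlK, and_true] using h l hl
    · simp [not_lt.2 hK]
  calc ∫⁻ ω, X ω ^ q ∂P = ∫⁻ ω, ⨆ K : ℕ, min (X ω) K ^ q ∂P := by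
        refine lintegral_congr fun ω => le_antisymm ?_ (iSup_le fun K => by gcongr; simp)
        obtain ⟨K, hK⟩ := ENNReal.exists_nat_gt (hX' ω)
        exact le_iSup_of_le K (by rw [min_eq_left hK.le])
    _ = ⨆ K : ℕ, ∫⁻ ω, min (X ω) K ^ q ∂P :=
        lintegral_iSup (fun K => (hX.min measurable_const).pow_const q) fun K L hKL ω => by
          dsimp only
          gcongr
    _ ≤ _ := iSup_le htrunc

end GoodLambda

section Restart

theorem maxPartialSum_le_add_tail {d e : ℕ → ℝ} {n N : ℕ} (hzero : ∀ j ≤ n, e j = 0)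
    (heq : ∀ j, n < j → j < N → e j = d j) :
    maxPartialSum d N ≤ maxPartialSum d n + ‖d n‖ₑ + maxPartialSum e N := by
  refine maxPartialSum_le fun M hM => ?_
  rcases le_or_gt M n with hMn | hnM
  · exact (enorm_sum_le_maxPartialSum d hMn).trans (le_self_add.trans le_self_add)
  · have htail : ∑ j ∈ Finset.range M, e j = ∑ j ∈ Finset.Ico (n + 1) M, d j := by
      rw [← Finset.sum_range_add_sum_Ico e hnM, Finset.sum_eq_zero fun j hj =>
        hzero j (Nat.lt_succ_iff.1 (Finset.mem_range.1 hj)), zero_add]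
      exact Finset.sum_congr rfl fun j hj =>
        heq j (Finset.mem_Ico.1 hj).1 ((Finset.mem_Ico.1 hj).2.trans_le hM)
    calc ‖∑ j ∈ Finset.range M, d j‖ₑ
        = ‖∑ j ∈ Finset.range n, d j + d n + ∑ j ∈ Finset.range M, e j‖ₑ := by
          rw [htail, ← Finset.sum_range_succ, Finset.sum_range_add_sum_Ico d hnM]
      _ ≤ ‖∑ j ∈ Finset.range n, d j‖ₑ + ‖d n‖ₑ + ‖∑ j ∈ Finset.range M, e j‖ₑ :=
          (enorm_add_le _ _).trans (by gcongr; exact enorm_add_le _ _)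
      _ ≤ maxPartialSum d n + ‖d n‖ₑ + maxPartialSum e N := by
          gcongr
          exacts [enorm_sum_le_maxPartialSum d le_rfl, enorm_sum_le_maxPartialSum e hM]

variable {Ω ι : Type*} {m : MeasurableSpace Ω} {ℱ : Filtration ℕ m} {P : Measure Ω} {r : ℝ≥0∞}
  {d : ι → ℕ → Ω → ℝ} {Z : ℕ → Ω → ℝ≥0∞} {l c : ℝ≥0} {ω : Ω}

/-- The event that at time `j` the maximal function has already exceeded `l`, while the predictable
majorant `Z` of the square function is still at most `c`. -/
def restartSet (r : ℝ≥0∞) (d : ι → ℕ → Ω → ℝ) (Z : ℕ → Ω → ℝ≥0∞) (l c : ℝ≥0) (j : ℕ) : Set Ω :=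
  {ω | l < ellMaxSum r d j ω ∧ Z j ω ≤ c}

/-- The increments restarted when the maximal function exceeds `l` and killed when the predictable
majorant `Z` of the square function exceeds `c`. -/
noncomputable def restart (r : ℝ≥0∞) (d : ι → ℕ → Ω → ℝ) (Z : ℕ → Ω → ℝ≥0∞) (l c : ℝ≥0) :
    ι → ℕ → Ω → ℝ :=
  fun k j => (restartSet r d Z l c j).indicator (d k j)

theorem enorm_restart_le (k : ι) (j : ℕ) : ‖restart r d Z l c k j ω‖ₑ ≤ ‖d k j ω‖ₑ :=
  enorm_indicator_le_enorm_self _ _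

theorem restart_eq_zero_of_le {j : ℕ} (h : ellMaxSum r d j ω ≤ l) (k : ι) :
    restart r d Z l c k j ω = 0 :=
  Set.indicator_of_notMem (fun hω => hω.1.not_ge h) _

theorem restart_eq_zero_of_lt {j : ℕ} (h : c < Z j ω) (k : ι) : restart r d Z l c k j ω = 0 :=
  Set.indicator_of_notMem (fun hω => hω.2.not_gt h) _

theorem enorm_restart_le_of_ellSquareFn_le (hr : r ≠ 0) (k : ι) {j : ℕ}
    (hZ : ellSquareFn r d (j + 1) ω ≤ Z j ω) : ‖restart r d Z l c k j ω‖ₑ ≤ c := by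
  rcases le_or_gt (Z j ω) c with hc | hc
  · calc ‖restart r d Z l c k j ω‖ₑ ≤ ‖d k j ω‖ₑ := enorm_restart_le k j
      _ ≤ squareFn (fun j => d k j ω) (j + 1) := enorm_le_squareFn (fun j => d k j ω) j.lt_succ_self
      _ ≤ ellSquareFn r d (j + 1) ω := le_ellNorm hr _ k
      _ ≤ c := hZ.trans hc
  · simp [restart_eq_zero_of_lt hc]

theorem ellSquareFn_restart_le (hr : r ≠ 0) (hZ : ∀ n, ellSquareFn r d (n + 1) ω ≤ Z n ω) (n : ℕ) :
    ellSquareFn r (restart r d Z l c) n ω ≤ c := by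
  induction n with
  | zero =>
    have hzero : ∀ k, squareFn (fun j => restart r d Z l c k j ω) 0 = 0 := fun k =>
      squareFn_eq_zero (by simp)
    simp [ellSquareFn, hzero, ellNorm_zero hr]
  | succ n ih =>
    rcases le_or_gt (Z n ω) c with hc | hc
    · calc ellSquareFn r (restart r d Z l c) (n + 1) ω ≤ ellSquareFn r d (n + 1) ω :=
            ellNorm_mono fun k => squareFn_mono_left fun j _ => enorm_restart_le k j
        _ ≤ c := (hZ n).trans hc
    · refine (ellNorm_mono fun k => ?_).trans ih
      simpa [restart_eq_zero_of_lt hc] using squareFn_succ_le (fun j => restart r d Z l c k j ω) n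

theorem ellSquareFn_restart_eq_zero (hr : r ≠ 0) {n : ℕ} (h : ellMaxSum r d n ω ≤ l) :
    ellSquareFn r (restart r d Z l c) n ω = 0 := by
  have hzero : ∀ k, squareFn (fun j => restart r d Z l c k j ω) n = 0 := fun k =>
    squareFn_eq_zero fun j hj =>
      restart_eq_zero_of_le ((ellMaxSum_mono r d ω hj.le).trans h) k
  simp [ellSquareFn, hzero, ellNorm_zero hr]

theorem lt_ellMaxSum_restart (hr : 1 ≤ r) {N : ℕ} (hcl : c ≤ l)
    (hZ : ∀ n, ellSquareFn r d (n + 1) ω ≤ Z n ω) (hZc : ∀ j < N, Z j ω ≤ c)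
    (h : 3 * l < ellMaxSum r d N ω) : l < ellMaxSum r (restart r d Z l c) N ω := by
  have hlN : (l : ℝ≥0∞) < ellMaxSum r d N ω :=
    (le_mul_of_one_le_left zero_le (by norm_num)).trans_lt h
  obtain ⟨k, hkN, hk⟩ := exists_crossing_time (ellMaxSum_mono r d ω) hlN
  obtain ⟨n, rfl⟩ : ∃ n, k = n + 1 := Nat.exists_eq_succ_of_ne_zero <| by
    rintro rfl
    have hzero : ellMaxSum r d 0 ω = 0 := by
      simp [ellMaxSum, maxPartialSum, ellNorm_zero (zero_lt_one.trans_le hr).ne']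
    exact absurd ((hk 0).1 (hzero.trans_le zero_le)) (lt_irrefl 0)
  have hjump : ellNorm r (fun k => ‖d k n ω‖ₑ) ≤ l :=
    calc ellNorm r (fun k => ‖d k n ω‖ₑ) ≤ ellSquareFn r d (n + 1) ω :=
          ellNorm_mono fun k => enorm_le_squareFn (fun j => d k j ω) n.lt_succ_self
      _ ≤ l := ((hZ n).trans (hZc n hkN)).trans (mod_cast hcl)
  have hsplit : ellMaxSum r d N ω ≤ l + l + ellMaxSum r (restart r d Z l c) N ω :=
    calc ellMaxSum r d N ω
        ≤ ellNorm r (fun k => maxPartialSum (fun j => d k j ω) n + ‖d k n ω‖ₑ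
            + maxPartialSum (fun j => restart r d Z l c k j ω) N) :=
          ellNorm_mono fun k => maxPartialSum_le_add_tail
            (fun j hj => restart_eq_zero_of_le ((hk j).2 (Nat.lt_succ_iff.2 hj)) k)
            fun j hnj hjN => Set.indicator_of_mem (s := restartSet r d Z l c j)
              ⟨not_le.1 fun hle => hnj.not_ge (Nat.lt_succ_iff.1 ((hk j).1 hle)), hZc j hjN⟩ _
      _ ≤ l + l + ellMaxSum r (restart r d Z l c) N ω := by
          refine (ellNorm_add_le hr _ _).trans ?_
          gcongr ?_ + _
          exact (ellNorm_add_le hr _ _).trans (add_le_add ((hk n).2 n.lt_succ_self) hjump)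
  by_contra! hcon
  refine h.not_ge (hsplit.trans ?_)
  calc (l + l + ellMaxSum r (restart r d Z l c) N ω : ℝ≥0∞) ≤ l + l + l := by gcongr
    _ = 3 * l := by ring

variable [Countable ι]

theorem measurableSet_restartSet (hd : ∀ k j, Measurable[ℱ (j + 1)] (d k j)) (hZ : Adapted ℱ Z)
    (j : ℕ) : MeasurableSet[ℱ j] (restartSet r d Z l c j) :=
  (adapted_ellMaxSum hd j measurableSet_Ioi).inter (hZ j measurableSet_Iic)

theorem memLp_top_restart (hr : r ≠ 0) (hd : ∀ k j, Measurable[ℱ (j + 1)] (d k j))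
    (hZ : Adapted ℱ Z) (hSZ : ∀ n, ∀ᵐ ω ∂P, ellSquareFn r d (n + 1) ω ≤ Z n ω) (k : ι) (j : ℕ) :
    MemLp (restart r d Z l c k j) ∞ P := by
  have hmeas : Measurable (restart r d Z l c k j) :=
    ((hd k j).mono (ℱ.le _) le_rfl).indicator (ℱ.le _ _ (measurableSet_restartSet hd hZ j))
  refine memLp_top_of_bound hmeas.aestronglyMeasurable c ?_
  filter_upwards [hSZ j] with ω hω
  exact_mod_cast (enorm_le_coe.1 (enorm_restart_le_of_ellSquareFn_le hr k hω))

theorem isMartingaleDiff_restart [IsFiniteMeasure P] (hr : r ≠ 0)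
    (hd : ∀ k, IsLocalMartingaleDiff ℱ P (d k)) (hZ : Adapted ℱ Z)
    (hSZ : ∀ n, ∀ᵐ ω ∂P, ellSquareFn r d (n + 1) ω ≤ Z n ω) (k : ι) :
    IsMartingaleDiff ℱ P (restart r d Z l c k) :=
  have hmeas := fun k => (hd k).measurable_succ
  (hd k).indicator (measurableSet_restartSet hmeas hZ) fun j =>
    (memLp_top_restart hr hmeas hZ hSZ k j).integrable le_top

theorem WeakTypeBDG.meas_lt_ellMaxSum_restart_le [IsFiniteMeasure P] (hr : r ≠ 0) (hr' : r ≠ ∞)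
    {C : ℝ≥0} (hC : WeakTypeBDG ℱ P ι r C) (hd : ∀ k, IsLocalMartingaleDiff ℱ P (d k))
    (hZ : Adapted ℱ Z) (hSZ : ∀ n, ∀ᵐ ω ∂P, ellSquareFn r d (n + 1) ω ≤ Z n ω) (δ : ℝ≥0)
    (hl : 0 < l) (N : ℕ) :
    P {ω | l < ellMaxSum r (restart r d Z l (δ * l)) N ω}
      ≤ C * (δ : ℝ≥0∞) ^ r.toReal * P {ω | l < ellMaxSum r d N ω} := by
  have hr0 : 0 < r.toReal := ENNReal.toReal_pos hr hr'
  have hmeas := fun k => (hd k).measurable_succ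
  have hset : MeasurableSet {ω | l < ellMaxSum r d N ω} :=
    ℱ.le N _ (adapted_ellMaxSum hmeas N measurableSet_Ioi)
  have hsq : ∫⁻ ω, ellSquareFn r (restart r d Z l (δ * l)) N ω ^ r.toReal ∂P
      ≤ ((δ * l : ℝ≥0) : ℝ≥0∞) ^ r.toReal * P {ω | l < ellMaxSum r d N ω} := by
    rw [← lintegral_indicator_const hset]
    refine lintegral_mono_ae ?_
    filter_upwards [ae_all_iff.2 hSZ] with ω hω
    by_cases hc : l < ellMaxSum r d N ω
    · rw [Set.indicator_of_mem (by exact hc)]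
      gcongr
      exact ellSquareFn_restart_le hr hω N
    · rw [ellSquareFn_restart_eq_zero hr (not_lt.1 hc), ENNReal.zero_rpow_of_pos hr0]
      exact zero_le
  have hl0 : (l : ℝ≥0∞) ^ r.toReal ≠ 0 := by simp [hl.ne']
  have hl1 : (l : ℝ≥0∞) ^ r.toReal ≠ ∞ := by finiteness
  rw [← ENNReal.mul_le_mul_iff_right hl0 hl1]
  calc (l : ℝ≥0∞) ^ r.toReal * P {ω | l < ellMaxSum r (restart r d Z l (δ * l)) N ω}
      ≤ C * ∫⁻ ω, ellSquareFn r (restart r d Z l (δ * l)) N ω ^ r.toReal ∂P :=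
        hC _ (isMartingaleDiff_restart hr hd hZ hSZ) (memLp_top_restart hr hmeas hZ hSZ) N l
    _ ≤ C * (((δ * l : ℝ≥0) : ℝ≥0∞) ^ r.toReal * P {ω | l < ellMaxSum r d N ω}) := by gcongr
    _ = l ^ r.toReal * (C * (δ : ℝ≥0∞) ^ r.toReal * P {ω | l < ellMaxSum r d N ω}) := by
        rw [ENNReal.coe_mul, ENNReal.mul_rpow_of_nonneg _ _ hr0.le]
        ring

theorem WeakTypeBDG.good_lambda [IsFiniteMeasure P] (hr : 1 ≤ r) (hr' : r ≠ ∞) {C : ℝ≥0}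
    (hC : WeakTypeBDG ℱ P ι r C) (hd : ∀ k, IsLocalMartingaleDiff ℱ P (d k)) (hZ : Adapted ℱ Z)
    (hSZ : ∀ n, ∀ᵐ ω ∂P, ellSquareFn r d (n + 1) ω ≤ Z n ω) {N : ℕ} {V : Ω → ℝ≥0∞}
    (hZV : ∀ j < N, ∀ ω, Z j ω ≤ V ω) {δ : ℝ≥0} (hδ : δ ≤ 1) (hl : 0 < l) :
    P {ω | 3 * l < ellMaxSum r d N ω}
      ≤ P {ω | δ * l < V ω} + C * (δ : ℝ≥0∞) ^ r.toReal * P {ω | l < ellMaxSum r d N ω} := by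
  calc P {ω | 3 * l < ellMaxSum r d N ω}
      ≤ P ({ω | δ * l < V ω} ∪ {ω | l < ellMaxSum r (restart r d Z l (δ * l)) N ω}) := by
        refine measure_mono_ae ?_
        filter_upwards [ae_all_iff.2 hSZ] with ω hω hlarge
        refine or_iff_not_imp_left.2 fun hV => ?_
        exact lt_ellMaxSum_restart hr (mul_le_of_le_one_left zero_le hδ) hω
          (fun j hj => (hZV j hj ω).trans (by simpa using hV)) hlarge
    _ ≤ _ := (measure_union_le _ _).trans <| by
        gcongr
        exact hC.meas_lt_ellMaxSum_restart_le (zero_lt_one.trans_le hr).ne' hr' hd hZ hSZ δ hl N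

theorem exists_mul_rpow_mul_le_half (C A : ℝ≥0) {p : ℝ} (hp : 1 ≤ p) :
    ∃ δ : ℝ≥0, δ ≠ 0 ∧ δ ≤ 1 ∧ (C * (δ : ℝ≥0∞) ^ p) * A ≤ 2⁻¹ := by
  have hpos : (0 : ℝ≥0) < 1 + 2 * (C * A) := by positivity
  have hinv : (1 + 2 * (C * A))⁻¹ ≤ 1 := inv_le_one_of_one_le₀ le_self_add
  refine ⟨(1 + 2 * (C * A))⁻¹, (inv_pos.2 hpos).ne', hinv, ?_⟩
  have hhalf : C * (1 + 2 * (C * A))⁻¹ ^ p * A ≤ 2⁻¹ :=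
    calc C * (1 + 2 * (C * A))⁻¹ ^ p * A ≤ C * (1 + 2 * (C * A))⁻¹ * A := by
          gcongr
          simpa using NNReal.rpow_le_rpow_of_exponent_ge (inv_pos.2 hpos) hinv hp
      _ = 2⁻¹ * (2 * (C * A) / (1 + 2 * (C * A))) := by field_simp
      _ ≤ 2⁻¹ := mul_le_of_le_one_right zero_le (div_le_one_of_le₀ le_add_self zero_le)
  rw [← ENNReal.coe_rpow_of_nonneg _ (zero_le_one.trans hp), ← ENNReal.coe_ofNat,
    ← ENNReal.coe_inv two_ne_zero]
  exact_mod_cast hhalf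

end Restart

theorem exists_eLpNorm_ellMaxSum_le_of_weakTypeBDG {r q : ℝ≥0∞} (hr : 1 ≤ r) (hr' : r ≠ ∞)
    (hq : q ≠ 0) (hq' : q ≠ ∞) (C : ℝ≥0) :
    ∃ C' : ℝ≥0, ∀ (Ω : Type*) {m : MeasurableSpace Ω} (P : Measure Ω) [IsFiniteMeasure P]
      (ℱ : Filtration ℕ m) (ι : Type*) [Finite ι], WeakTypeBDG ℱ P ι r C →
      ∀ d : ι → ℕ → Ω → ℝ, (∀ k, IsLocalMartingaleDiff ℱ P (d k)) →
      ∀ Z : ℕ → Ω → ℝ≥0∞, Adapted ℱ Z → (∀ n, ∀ᵐ ω ∂P, ellSquareFn r d (n + 1) ω ≤ Z n ω) →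
      ∀ (N : ℕ) (V : Ω → ℝ≥0∞), Measurable V → (∀ ω, V ω ≠ ∞) → (∀ j < N, ∀ ω, Z j ω ≤ V ω) →
      eLpNorm (ellMaxSum r d N) q P ≤ C' * eLpNorm V q P := by
  have hr1 : 1 ≤ r.toReal := by simpa using ENNReal.toReal_mono hr' hr
  have hq0 : 0 < q.toReal := ENNReal.toReal_pos hq hq'
  obtain ⟨δ, hδ0, hδ1, hδ⟩ := exists_mul_rpow_mul_le_half C (3 ^ q.toReal) hr1
  rw [ENNReal.coe_rpow_of_nonneg _ hq0.le] at hδ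
  refine ⟨(2 * (3 / δ) ^ q.toReal) ^ (1 / q.toReal), ?_⟩
  intro Ω m P _ ℱ ι _ hC d hd Z hZ hSZ N V hV hV' hZV
  exact eLpNorm_ennreal_le_mul_of_lintegral_rpow_le hq hq' <|
    lintegral_rpow_le_of_good_lambda (measurable_ellMaxSum fun k j _ => (hd k).measurable j) hV
      (ellMaxSum_ne_top N) hV' hδ0 hq0 hδ fun l hl =>
        hC.good_lambda hr hr' hd hZ hSZ hZV hδ1 hl

theorem ellNorm_enorm_eq_ofReal_norm {ι : Type*} [Fintype ι] {r : ℝ≥0∞} [hr : Fact (1 ≤ r)]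
    (hr' : r ≠ ∞) (x : PiLp r fun _ : ι => ℝ) :
    (ellNorm r fun k => ‖x k‖ₑ) = ENNReal.ofReal ‖x‖ := by
  have hr0 := ENNReal.toReal_pos (zero_lt_one.trans_le hr.out).ne' hr'
  rw [ellNorm, if_neg hr', tsum_fintype, PiLp.norm_eq_sum hr0,
    ← ENNReal.ofReal_rpow_of_nonneg (Finset.sum_nonneg fun _ _ => by positivity) (by positivity),
    ENNReal.ofReal_sum_of_nonneg fun _ _ => by positivity]
  simp_rw [← ENNReal.ofReal_rpow_of_nonneg (norm_nonneg _) hr0.le, ofReal_norm]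

theorem ellNorm_condExp_le {Ω : Type*} {m' m : MeasurableSpace Ω} {P : Measure Ω}
    {ι : Type*} [Finite ι] {r : ℝ≥0∞} (hr : 1 ≤ r) (hr' : r ≠ ∞)
    {a : ι → Ω → ℝ} (ha : ∀ k, Integrable (a k) P) :
    ∀ᵐ ω ∂P, (ellNorm r fun k => ‖P[a k | m'] ω‖ₑ)
      ≤ P⁻[fun ω => ellNorm r fun k => ‖a k ω‖ₑ | m'] ω := by
  have : Fact (1 ≤ r) := ⟨hr⟩
  have := Fintype.ofFinite ι
  let v : Ω → PiLp r fun _ : ι => ℝ := fun ω => WithLp.toLp r fun k => a k ω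
  have hv : Integrable v P := Integrable.of_eval_piLp ha
  have hcoord : ∀ k, ∀ᵐ ω ∂P, P[v | m'] ω k = P[a k | m'] ω := fun k =>
    ContinuousLinearMap.comp_condExp_comm (m := m') hv (PiLp.proj (𝕜 := ℝ) r (fun _ : ι => ℝ) k)
  have hofReal : P⁻[fun ω => ellNorm r fun k => ‖a k ω‖ₑ | m']
      =ᵐ[P] fun ω => ENNReal.ofReal (P[fun ω => ‖v ω‖ | m'] ω) := by
    have heq : (fun ω => ellNorm r fun k => ‖a k ω‖ₑ) = fun ω => ENNReal.ofReal ‖v ω‖ :=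
      funext fun ω => ellNorm_enorm_eq_ofReal_norm hr' (v ω)
    exact heq ▸ condLExp_ofReal m' hv.norm (.of_forall fun _ => norm_nonneg _)
  filter_upwards [norm_condExp_le (m := m') (μ := P) v, ae_all_iff.2 hcoord, hofReal]
    with ω hω hcoordω hofRealω
  simp_rw [← hcoordω, ellNorm_enorm_eq_ofReal_norm hr', hofRealω]
  exact ENNReal.ofReal_le_ofReal hω

section CondLExp

variable {Ω : Type*} {m' m : MeasurableSpace Ω} {P : Measure Ω} [IsFiniteMeasure P]

theorem lintegral_condLExp_mul (hm : m' ≤ m) {w W : Ω → ℝ≥0∞} (hw : AEMeasurable w P)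
    (hW : Measurable[m'] W) :
    ∫⁻ ω, P⁻[w | m'] ω * W ω ∂P = ∫⁻ ω, w ω * W ω ∂P := by
  have hdensity : (P.withDensity P⁻[w | m']).trim hm = (P.withDensity w).trim hm := by
    refine @Measure.ext _ m' _ _ fun s hs => ?_
    rw [trim_measurableSet_eq hm hs, trim_measurableSet_eq hm hs, withDensity_apply _ (hm s hs),
      withDensity_apply _ (hm s hs), setLIntegral_condLExp hm P w hs]
  have hWm : AEMeasurable W P := (hW.mono hm le_rfl).aemeasurable
  calc ∫⁻ ω, P⁻[w | m'] ω * W ω ∂P = ∫⁻ ω, W ω ∂(P.withDensity P⁻[w | m']) :=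
        (lintegral_withDensity_eq_lintegral_mul₀ (measurable_condLExp' _ _ _).aemeasurable
          hWm).symm
    _ = ∫⁻ ω, W ω ∂(P.withDensity w) := by
        rw [← lintegral_trim hm hW, ← lintegral_trim hm hW, hdensity]
    _ = ∫⁻ ω, w ω * W ω ∂P := lintegral_withDensity_eq_lintegral_mul₀ hw hWm

theorem eLpNorm_condLExp_le {w : Ω → ℝ≥0∞} (hw : AEMeasurable w P) {q : ℝ≥0∞} (hq : 1 ≤ q) :
    eLpNorm P⁻[w | m'] q P ≤ eLpNorm w q P := by
  rcases eq_or_ne (eLpNorm w q P) ∞ with htop | hfin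
  · exact htop ▸ le_top
  have hint : ∫⁻ ω, w ω ∂P ≠ ∞ := by
    have hL1 := (MemLp.mono_exponent ⟨hw.aestronglyMeasurable, hfin.lt_top⟩ hq).2.ne
    simpa only [eLpNorm_one_eq_lintegral_enorm, enorm_eq_self] using hL1
  calc eLpNorm P⁻[w | m'] q P = eLpNorm (P[fun ω => (w ω).toReal | m']) q P := by
        refine eLpNorm_congr_enorm_ae ?_
        filter_upwards [toReal_condLExp m' hw hint, condLExp_ne_top hint] with ω hω hne
        rw [← hω, Real.enorm_eq_ofReal ENNReal.toReal_nonneg, ENNReal.ofReal_toReal hne,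
          enorm_eq_self]
    _ ≤ eLpNorm (fun ω => (w ω).toReal) q P := eLpNorm_condExp_le_eLpNorm _ hq
    _ ≤ eLpNorm w q P := eLpNorm_mono_enorm fun ω => by
        rw [Real.enorm_eq_ofReal ENNReal.toReal_nonneg, enorm_eq_self]
        exact ENNReal.ofReal_toReal_le

end CondLExp

section DualDoob

theorem real_add_rpow_le_rpow_add_mul {q : ℝ} (hq : 1 ≤ q) {a c : ℝ} (ha : 0 ≤ a) (hc : 0 ≤ c) :
    (a + c) ^ q ≤ a ^ q + q * (c * (a + c) ^ (q - 1)) := by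
  rcases (add_nonneg ha hc).eq_or_lt' with h0 | hpos
  · rw [h0, Real.zero_rpow (by linarith)]
    positivity
  have hbernoulli : 1 + q * -(c / (a + c)) ≤ (1 + -(c / (a + c))) ^ q :=
    one_add_mul_self_le_rpow_one_add
      (neg_le_neg ((div_le_one hpos).2 (le_add_of_nonneg_left ha))) hq
  have hdiv : 1 + -(c / (a + c)) = a / (a + c) := by
    field_simp
    ring
  rw [hdiv, Real.div_rpow ha hpos.le, le_div_iff₀ (Real.rpow_pos_of_pos hpos q)] at hbernoulli
  rw [Real.rpow_sub_one hpos.ne']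
  have hexpand : (1 + q * -(c / (a + c))) * (a + c) ^ q
      = (a + c) ^ q - q * (c * ((a + c) ^ q / (a + c))) := by
    field_simp
    ring
  linarith

theorem add_rpow_le_rpow_add_mul {q : ℝ} (hq : 1 ≤ q) (a c : ℝ≥0∞) :
    (a + c) ^ q ≤ a ^ q + ENNReal.ofReal q * (c * (a + c) ^ (q - 1)) := by
  have hq0 : 0 < q := zero_lt_one.trans_le hq
  rcases eq_or_ne a ∞ with rfl | ha
  · simp [ENNReal.top_rpow_of_pos hq0]
  rcases eq_or_ne c ∞ with rfl | hc
  · rcases hq.eq_or_lt with rfl | hq1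
    · simp
    · simp [ENNReal.top_rpow_of_pos (sub_pos.2 hq1), ENNReal.mul_top, hq0]
  lift a to ℝ≥0 using ha
  lift c to ℝ≥0 using hc
  lift q to ℝ≥0 using hq0.le
  have hq1 : (0 : ℝ) ≤ q - 1 := sub_nonneg.2 hq
  rw [← ENNReal.coe_add, ← ENNReal.coe_rpow_of_nonneg _ hq0.le,
    ← ENNReal.coe_rpow_of_nonneg _ hq0.le, ← ENNReal.coe_rpow_of_nonneg _ hq1,
    ENNReal.ofReal_coe_nnreal]
  exact_mod_cast real_add_rpow_le_rpow_add_mul hq a.coe_nonneg c.coe_nonneg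

theorem sum_rpow_le_mul_sum {q : ℝ} (hq : 1 ≤ q) (c : ℕ → ℝ≥0∞) (N : ℕ) :
    (∑ j ∈ Finset.range N, c j) ^ q
      ≤ ENNReal.ofReal q * ∑ n ∈ Finset.range N,
          c n * (∑ j ∈ Finset.range (n + 1), c j) ^ (q - 1) := by
  induction N with
  | zero => simp [ENNReal.zero_rpow_of_pos (zero_lt_one.trans_le hq)]
  | succ N ih =>
    rw [Finset.sum_range_succ (fun n => c n * (∑ j ∈ Finset.range (n + 1), c j) ^ (q - 1)),
      mul_add, Finset.sum_range_succ c N]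
    exact (add_rpow_le_rpow_add_mul hq _ _).trans (by gcongr)

variable {Ω : Type*} {m : MeasurableSpace Ω} {P : Measure Ω} [IsFiniteMeasure P]

theorem lintegral_sum_condLExp_rpow_le (ℱ : Filtration ℕ m) {w : ℕ → Ω → ℝ≥0∞}
    (hw : ∀ j, AEMeasurable (w j) P) {q : ℝ} (hq : 1 ≤ q) (N : ℕ) :
    ∫⁻ ω, (∑ j ∈ Finset.range N, P⁻[w j | ℱ j] ω) ^ q ∂P
      ≤ ENNReal.ofReal q * ((∫⁻ ω, (∑ j ∈ Finset.range N, w j ω) ^ q ∂P) ^ (1 / q)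
        * (∫⁻ ω, (∑ j ∈ Finset.range N, P⁻[w j | ℱ j] ω) ^ q ∂P) ^ ((q - 1) / q)) := by
  have hq0 : 0 < q := zero_lt_one.trans_le hq
  set A : ℕ → Ω → ℝ≥0∞ := fun n ω => ∑ j ∈ Finset.range n, P⁻[w j | ℱ j] ω
  have hA : ∀ n, Measurable[ℱ n] (A (n + 1)) := fun n =>
    @Finset.measurable_sum _ _ _ _ _ _ (ℱ n) _ _ fun j hj =>
      (measurable_condLExp (ℱ j) P (w j)).mono
        (ℱ.mono (Nat.lt_succ_iff.1 (Finset.mem_range.1 hj))) le_rfl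
  have hAm : Measurable (A N) :=
    Finset.measurable_sum _ fun j _ => measurable_condLExp' (ℱ j) P (w j)
  calc ∫⁻ ω, A N ω ^ q ∂P
      ≤ ∫⁻ ω, ENNReal.ofReal q * ∑ n ∈ Finset.range N,
          P⁻[w n | ℱ n] ω * A (n + 1) ω ^ (q - 1) ∂P :=
        lintegral_mono fun ω => sum_rpow_le_mul_sum hq (fun j => P⁻[w j | ℱ j] ω) N
    _ = ENNReal.ofReal q * ∑ n ∈ Finset.range N,
          ∫⁻ ω, P⁻[w n | ℱ n] ω * A (n + 1) ω ^ (q - 1) ∂P := by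
        rw [lintegral_const_mul' _ _ ENNReal.ofReal_ne_top, lintegral_finsetSum]
        exact fun n _ => (measurable_condLExp' _ _ _).mul
          (((hA n).mono (ℱ.le n) le_rfl).pow_const _)
    _ = ENNReal.ofReal q * ∑ n ∈ Finset.range N, ∫⁻ ω, w n ω * A (n + 1) ω ^ (q - 1) ∂P := by
        simp_rw [fun n => lintegral_condLExp_mul (ℱ.le n) (hw n) ((hA n).pow_const (q - 1))]
    _ ≤ ENNReal.ofReal q * ∑ n ∈ Finset.range N, ∫⁻ ω, w n ω * A N ω ^ (q - 1) ∂P := by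
        gcongr with n hn ω
        exact Finset.sum_le_sum_of_subset (Finset.range_mono (Finset.mem_range.1 hn))
    _ = ENNReal.ofReal q * ∫⁻ ω, ((∑ n ∈ Finset.range N, w n ω) ^ q) ^ (1 / q)
          * (A N ω ^ q) ^ ((q - 1) / q) ∂P := by
        rw [← lintegral_finsetSum' (f := fun n ω => w n ω * A N ω ^ (q - 1)) _ fun n _ =>
          (hw n).mul (hAm.pow_const _).aemeasurable]
        simp_rw [← ENNReal.rpow_mul, mul_one_div_cancel hq0.ne', ENNReal.rpow_one,
          mul_div_cancel₀ (q - 1) hq0.ne', Finset.sum_mul]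
    _ ≤ _ := by
        gcongr
        refine ENNReal.lintegral_mul_norm_pow_le
          ((Finset.aemeasurable_fun_sum _ fun j _ => hw j).pow_const _)
          (hAm.pow_const _).aemeasurable (by positivity)
          (div_nonneg (by linarith) hq0.le) ?_
        field_simp
        ring

theorem rpow_one_div_le_of_le_mul_rpow {q : ℝ} (hq : 1 ≤ q) {I a : ℝ≥0∞} (hI : I ≠ ∞)
    (h : I ≤ a * I ^ ((q - 1) / q)) : I ^ (1 / q) ≤ a := by
  have hq0 : 0 < q := zero_lt_one.trans_le hq
  rcases eq_or_ne I 0 with rfl | h0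
  · simp [ENNReal.zero_rpow_of_pos (inv_pos.2 hq0)]
  have hsplit : I = I ^ (1 / q) * I ^ ((q - 1) / q) := by
    rw [← ENNReal.rpow_add _ _ h0 hI, ← add_div, add_sub_cancel, div_self hq0.ne',
      ENNReal.rpow_one]
  have hpos : I ^ ((q - 1) / q) ≠ 0 := by simp [ENNReal.rpow_eq_zero_iff, h0, hI]
  have hfin : I ^ ((q - 1) / q) ≠ ∞ :=
    ENNReal.rpow_ne_top_of_nonneg (div_nonneg (by linarith) hq0.le) hI
  rwa [← ENNReal.mul_le_mul_iff_left hpos hfin, ← hsplit]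

theorem eLpNorm_sum_condLExp_le (ℱ : Filtration ℕ m) {w : ℕ → Ω → ℝ≥0∞}
    (hw : ∀ j, AEMeasurable (w j) P) {q : ℝ≥0∞} (hq : 1 ≤ q) (hq' : q ≠ ∞) (N : ℕ) :
    eLpNorm (fun ω => ∑ j ∈ Finset.range N, P⁻[w j | ℱ j] ω) q P
      ≤ q * eLpNorm (fun ω => ∑ j ∈ Finset.range N, w j ω) q P := by
  have hq0 : q ≠ 0 := (zero_lt_one.trans_le hq).ne'
  have hq1 : 1 ≤ q.toReal := by simpa using ENNReal.toReal_mono hq' hq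
  rcases eq_or_ne (eLpNorm (fun ω => ∑ j ∈ Finset.range N, w j ω) q P) ∞ with htop | hfin
  · rw [htop, ENNReal.mul_top hq0]
    exact le_top
  have hcondfin : eLpNorm (fun ω => ∑ j ∈ Finset.range N, P⁻[w j | ℱ j] ω) q P ≠ ∞ := by
    refine ne_top_of_le_ne_top (ENNReal.sum_ne_top.2 fun j hj => ?_)
      (eLpNorm_ennreal_sum_le hq _ fun j _ => (measurable_condLExp' _ _ _).aemeasurable)
    refine ne_top_of_le_ne_top hfin ((eLpNorm_condLExp_le (hw j) hq).trans ?_)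
    refine eLpNorm_mono_enorm fun ω => ?_
    exact Finset.single_le_sum (f := fun j => w j ω) (fun _ _ => zero_le) hj
  have hI : ∫⁻ ω, (∑ j ∈ Finset.range N, P⁻[w j | ℱ j] ω) ^ q.toReal ∂P ≠ ∞ := by
    rw [← eLpNorm_ennreal_rpow hq0 hq']
    exact ENNReal.rpow_ne_top_of_nonneg ENNReal.toReal_nonneg hcondfin
  rw [eLpNorm_ennreal_eq hq0 hq', eLpNorm_ennreal_eq hq0 hq']
  have hmain := lintegral_sum_condLExp_rpow_le ℱ hw hq1 N
  rw [ENNReal.ofReal_toReal hq', ← mul_assoc] at hmain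
  exact rpow_one_div_le_of_le_mul_rpow hq1 hI hmain

end DualDoob

section Davis

variable {ι Ω : Type*} {m : MeasurableSpace Ω} {ℱ : Filtration ℕ m} {P : Measure Ω} {r : ℝ≥0∞}
  {d : ι → ℕ → Ω → ℝ}

/-- The maximal `ℓ^r` norm `max_{j < n} ‖d_j‖_{ℓ^r}` of a family of sequences of increments. -/
noncomputable def maxIncr (r : ℝ≥0∞) (d : ι → ℕ → Ω → ℝ) (n : ℕ) (ω : Ω) : ℝ≥0∞ :=
  (Finset.range n).sup fun j => ellNorm r fun k => ‖d k j ω‖ₑ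

/-- The event that the `j`-th increment is a large jump: its `ℓ^r` norm is more than twice that of
all the previous increments. -/
def jumpSet (r : ℝ≥0∞) (d : ι → ℕ → Ω → ℝ) (j : ℕ) : Set Ω :=
  {ω | 2 * maxIncr r d j ω < ellNorm r fun k => ‖d k j ω‖ₑ}

/-- The part of the increments consisting of large jumps. -/
noncomputable def largeIncr (r : ℝ≥0∞) (d : ι → ℕ → Ω → ℝ) : ι → ℕ → Ω → ℝ :=
  fun k j => (jumpSet r d j).indicator (d k j)

/-- The part of the increments without large jumps. -/
noncomputable def smallIncr (r : ℝ≥0∞) (d : ι → ℕ → Ω → ℝ) : ι → ℕ → Ω → ℝ :=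
  fun k j => (jumpSet r d j)ᶜ.indicator (d k j)

/-- The martingale part of the Davis decomposition: the compensated small increments. -/
noncomputable def davisMartingale (ℱ : Filtration ℕ m) (P : Measure Ω) (r : ℝ≥0∞)
    (d : ι → ℕ → Ω → ℝ) : ι → ℕ → Ω → ℝ :=
  fun k j ω => smallIncr r d k j ω - P[smallIncr r d k j | ℱ j] ω

/-- The part of bounded variation of the Davis decomposition. -/
noncomputable def davisRemainder (ℱ : Filtration ℕ m) (P : Measure Ω) (r : ℝ≥0∞)
    (d : ι → ℕ → Ω → ℝ) : ι → ℕ → Ω → ℝ :=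
  fun k j ω => d k j ω - davisMartingale ℱ P r d k j ω

/-- The variation `∑_{j < n} ‖u_j‖_{ℓ^r}` of the second part `u` of the Davis decomposition. -/
noncomputable def davisVariation (ℱ : Filtration ℕ m) (P : Measure Ω) (r : ℝ≥0∞)
    (d : ι → ℕ → Ω → ℝ) (n : ℕ) (ω : Ω) : ℝ≥0∞ :=
  ∑ j ∈ Finset.range n, ellNorm r fun k => ‖davisRemainder ℱ P r d k j ω‖ₑ

/-- An adapted bound at time `n` for the square function at time `n + 1` of the martingale part of
the Davis decomposition. -/
noncomputable def davisBound (ℱ : Filtration ℕ m) (P : Measure Ω) (r : ℝ≥0∞)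
    (d : ι → ℕ → Ω → ℝ) (n : ℕ) (ω : Ω) : ℝ≥0∞ :=
  ellSquareFn r (davisMartingale ℱ P r d) n ω + 4 * maxIncr r d n ω

theorem maxIncr_mono (r : ℝ≥0∞) (d : ι → ℕ → Ω → ℝ) (ω : Ω) : Monotone fun n => maxIncr r d n ω :=
  fun _ _ h => Finset.sup_mono (Finset.range_mono h)

theorem ellNorm_le_maxIncr {j n : ℕ} (h : j < n) (ω : Ω) :
    (ellNorm r fun k => ‖d k j ω‖ₑ) ≤ maxIncr r d n ω :=
  Finset.le_sup (f := fun j => ellNorm r fun k => ‖d k j ω‖ₑ) (Finset.mem_range.2 h)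

theorem maxIncr_le_ellSquareFn (n : ℕ) (ω : Ω) : maxIncr r d n ω ≤ ellSquareFn r d n ω :=
  Finset.sup_le fun _ hj => ellNorm_mono fun _ => enorm_le_squareFn _ (Finset.mem_range.1 hj)

theorem measurable_maxIncr [Countable ι] {n : ℕ} (h : ∀ k, ∀ j < n, Measurable (d k j)) :
    Measurable (maxIncr r d n) := by
  unfold maxIncr
  simp only [Finset.sup_eq_iSup]
  exact Measurable.iSup fun j => Measurable.iSup fun hj =>
    measurable_ellNorm fun k => (h k j (Finset.mem_range.1 hj)).enorm

theorem adapted_maxIncr [Countable ι] (hd : ∀ k j, Measurable[ℱ (j + 1)] (d k j)) :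
    Adapted ℱ (maxIncr r d) := fun n =>
  measurable_maxIncr (m := ℱ n) fun k j hj => (hd k j).mono (ℱ.mono hj) le_rfl

theorem measurableSet_jumpSet [Countable ι] (hd : ∀ k j, Measurable[ℱ (j + 1)] (d k j)) (j : ℕ) :
    MeasurableSet[ℱ (j + 1)] (jumpSet r d j) := by
  have hmax : Measurable[ℱ (j + 1)] fun ω => 2 * maxIncr r d j ω :=
    ((adapted_maxIncr hd j).mono (ℱ.mono j.le_succ) le_rfl).const_mul 2
  have hincr : Measurable[ℱ (j + 1)] fun ω => ellNorm r fun k => ‖d k j ω‖ₑ :=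
    @measurable_ellNorm ι _ Ω (ℱ (j + 1)) _ _ fun k => measurable_enorm.comp (hd k j)
  exact measurableSet_lt hmax hincr

theorem largeIncr_add_smallIncr (k : ι) (j : ℕ) : largeIncr r d k j + smallIncr r d k j = d k j :=
  Set.indicator_self_add_compl _ _

theorem ellNorm_smallIncr_le (hr : r ≠ 0) (j : ℕ) (ω : Ω) :
    (ellNorm r fun k => ‖smallIncr r d k j ω‖ₑ) ≤ 2 * maxIncr r d j ω := by
  by_cases hω : ω ∈ jumpSet r d j
  · simp [smallIncr, hω, ellNorm_zero hr]
  · simp only [smallIncr, Set.indicator_of_mem (Set.mem_compl hω)]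
    exact not_lt.1 hω

/-- Successive large jumps at least double the maximum, so their sum is a geometric series. -/
theorem sum_ellNorm_largeIncr_le (hr : r ≠ 0) (n : ℕ) (ω : Ω) :
    ∑ j ∈ Finset.range n, (ellNorm r fun k => ‖largeIncr r d k j ω‖ₑ) ≤ 2 * maxIncr r d n ω := by
  induction n with
  | zero => simp
  | succ n ih =>
    rw [Finset.sum_range_succ]
    by_cases hω : ω ∈ jumpSet r d n
    · simp only [largeIncr, Set.indicator_of_mem hω] at ih ⊢
      have hlast := ellNorm_le_maxIncr (r := r) (d := d) n.lt_succ_self ω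
      calc _ ≤ maxIncr r d (n + 1) ω + maxIncr r d (n + 1) ω := by
            gcongr
            exact ih.trans ((le_of_lt hω).trans hlast)
        _ = 2 * maxIncr r d (n + 1) ω := (two_mul _).symm
    · have hzero : (ellNorm r fun k => ‖largeIncr r d k n ω‖ₑ) = 0 := by
        simp [largeIncr, hω, ellNorm_zero hr]
      rw [hzero, add_zero]
      exact ih.trans (by gcongr; exact maxIncr_mono r d ω n.le_succ)

theorem integrable_largeIncr [Countable ι] (hd : ∀ k, IsMartingaleDiff ℱ P (d k)) (k : ι) (j : ℕ) :
    Integrable (largeIncr r d k j) P :=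
  ((hd k).integrable j).indicator
    (ℱ.le _ _ (measurableSet_jumpSet (fun k => (hd k).measurable_succ) j))

theorem integrable_smallIncr [Countable ι] (hd : ∀ k, IsMartingaleDiff ℱ P (d k)) (k : ι) (j : ℕ) :
    Integrable (smallIncr r d k j) P :=
  ((hd k).integrable j).indicator
    (ℱ.le _ _ (measurableSet_jumpSet (fun k => (hd k).measurable_succ) j)).compl

theorem measurable_smallIncr [Countable ι] (hd : ∀ k j, Measurable[ℱ (j + 1)] (d k j)) (k : ι)
    (j : ℕ) : Measurable[ℱ (j + 1)] (smallIncr r d k j) :=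
  (hd k j).indicator (measurableSet_jumpSet hd j).compl

theorem measurable_davisMartingale [Countable ι] (hd : ∀ k j, Measurable[ℱ (j + 1)] (d k j))
    (k : ι) (j : ℕ) : Measurable[ℱ (j + 1)] (davisMartingale ℱ P r d k j) :=
  (measurable_smallIncr hd k j).sub
    (stronglyMeasurable_condExp.measurable.mono (ℱ.mono j.le_succ) le_rfl)

theorem davisRemainder_ae_eq [Countable ι] (hd : ∀ k, IsMartingaleDiff ℱ P (d k)) (k : ι) (j : ℕ) :
    ∀ᵐ ω ∂P, davisRemainder ℱ P r d k j ω
      = largeIncr r d k j ω - P[largeIncr r d k j | ℱ j] ω := by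
  have hadd := condExp_add (integrable_largeIncr (r := r) hd k j)
    (integrable_smallIncr (r := r) hd k j) (ℱ j)
  rw [largeIncr_add_smallIncr] at hadd
  filter_upwards [hadd, (hd k).condExp_eq_zero j] with ω haddω hzero
  have hsplit := congrFun (largeIncr_add_smallIncr (r := r) (d := d) k j) ω
  simp only [Pi.add_apply] at hsplit haddω
  rw [hzero, Pi.zero_apply] at haddω
  rw [davisRemainder, davisMartingale]
  linarith

theorem ellNorm_davisRemainder_le [Finite ι] (hr : 1 ≤ r) (hr' : r ≠ ∞)
    (hd : ∀ k, IsMartingaleDiff ℱ P (d k)) (j : ℕ) :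
    ∀ᵐ ω ∂P, (ellNorm r fun k => ‖davisRemainder ℱ P r d k j ω‖ₑ)
      ≤ (ellNorm r fun k => ‖largeIncr r d k j ω‖ₑ)
        + P⁻[fun ω => ellNorm r fun k => ‖largeIncr r d k j ω‖ₑ | ℱ j] ω := by
  filter_upwards [ellNorm_condExp_le (m' := ℱ j) hr hr' fun k => integrable_largeIncr hd k j,
    ae_all_iff.2 fun k => davisRemainder_ae_eq hd k j] with ω hjensen heq
  calc (ellNorm r fun k => ‖davisRemainder ℱ P r d k j ω‖ₑ)
      = ellNorm r fun k => ‖largeIncr r d k j ω - P[largeIncr r d k j | ℱ j] ω‖ₑ := by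
        congr 1; funext k; rw [heq k]
    _ ≤ ellNorm r fun k => ‖largeIncr r d k j ω‖ₑ + ‖P[largeIncr r d k j | ℱ j] ω‖ₑ :=
        ellNorm_mono fun k => enorm_sub_le
    _ ≤ _ := (ellNorm_add_le hr _ _).trans (by gcongr)

theorem davisBound_le (hr : 1 ≤ r) {n N : ℕ} (h : n ≤ N) (ω : Ω) :
    davisBound ℱ P r d n ω ≤ 5 * ellSquareFn r d N ω + davisVariation ℱ P r d N ω := by
  have hsquare : ellSquareFn r (davisMartingale ℱ P r d) n ω
      ≤ ellSquareFn r d N ω + davisVariation ℱ P r d N ω :=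
    (ellSquareFn_mono r _ ω h).trans (ellSquareFn_le_add_sum_sub hr _ _ N ω)
  have hincr : maxIncr r d n ω ≤ ellSquareFn r d N ω :=
    (maxIncr_mono r d ω h).trans (maxIncr_le_ellSquareFn N ω)
  calc davisBound ℱ P r d n ω
      ≤ (ellSquareFn r d N ω + davisVariation ℱ P r d N ω) + 4 * ellSquareFn r d N ω := by
        rw [davisBound]
        gcongr
    _ = 5 * ellSquareFn r d N ω + davisVariation ℱ P r d N ω := by ring

variable [IsFiniteMeasure P]

theorem isMartingaleDiff_davisMartingale [Countable ι] (hd : ∀ k, IsMartingaleDiff ℱ P (d k))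
    (k : ι) : IsMartingaleDiff ℱ P (davisMartingale ℱ P r d k) where
  measurable_succ := measurable_davisMartingale (fun k => (hd k).measurable_succ) k
  integrable j := (integrable_smallIncr hd k j).sub integrable_condExp
  condExp_eq_zero j := by
    have hsub := condExp_sub (integrable_smallIncr (r := r) hd k j)
      (integrable_condExp (f := smallIncr r d k j) (m := ℱ j)) (ℱ j)
    rwa [condExp_of_stronglyMeasurable (ℱ.le j) stronglyMeasurable_condExp integrable_condExp,
      sub_self] at hsub

theorem ellNorm_davisMartingale_le [Finite ι] (hr : 1 ≤ r) (hr' : r ≠ ∞)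
    (hd : ∀ k, IsMartingaleDiff ℱ P (d k)) (j : ℕ) :
    ∀ᵐ ω ∂P, (ellNorm r fun k => ‖davisMartingale ℱ P r d k j ω‖ₑ) ≤ 4 * maxIncr r d j ω := by
  have hsmall := ellNorm_smallIncr_le (d := d) (zero_lt_one.trans_le hr).ne' j
  have hpredictable : Measurable[ℱ j] fun ω => 2 * maxIncr r d j ω :=
    (adapted_maxIncr (fun k => (hd k).measurable_succ) j).const_mul 2
  filter_upwards [ellNorm_condExp_le (m' := ℱ j) hr hr' fun k => integrable_smallIncr hd k j,
    condLExp_mono (mΩ := ℱ j) (.of_forall hsmall)] with ω hjensen hmono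
  rw [condLExp_eq_self (ℱ.le j) P hpredictable] at hmono
  calc (ellNorm r fun k => ‖davisMartingale ℱ P r d k j ω‖ₑ)
      ≤ ellNorm r fun k => ‖smallIncr r d k j ω‖ₑ + ‖P[smallIncr r d k j | ℱ j] ω‖ₑ :=
        ellNorm_mono fun k => enorm_sub_le
    _ ≤ 2 * maxIncr r d j ω + 2 * maxIncr r d j ω :=
        (ellNorm_add_le hr _ _).trans (add_le_add (hsmall ω) (hjensen.trans hmono))
    _ = 4 * maxIncr r d j ω := by ring

theorem eLpNorm_davisVariation_le [Finite ι] (hr : 1 ≤ r) (hr' : r ≠ ∞)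
    (hd : ∀ k, IsMartingaleDiff ℱ P (d k)) {q : ℝ≥0∞} (hq : 1 ≤ q) (hq' : q ≠ ∞) (N : ℕ) :
    eLpNorm (davisVariation ℱ P r d N) q P ≤ 2 * (1 + q) * eLpNorm (ellSquareFn r d N) q P := by
  have hr0 : r ≠ 0 := (zero_lt_one.trans_le hr).ne'
  set w : ℕ → Ω → ℝ≥0∞ := fun j ω => ellNorm r fun k => ‖largeIncr r d k j ω‖ₑ
  have hw : ∀ j, Measurable (w j) := fun j => measurable_ellNorm fun k =>
    ((hd k).measurable j).indicator
      (ℱ.le _ _ (measurableSet_jumpSet (fun k => (hd k).measurable_succ) j)) |>.enorm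
  have hsum : eLpNorm (fun ω => ∑ j ∈ Finset.range N, w j ω) q P
      ≤ 2 * eLpNorm (ellSquareFn r d N) q P := by
    refine (eLpNorm_mono_enorm (g := fun ω => 2 * ellSquareFn r d N ω) fun ω =>
      (sum_ellNorm_largeIncr_le (d := d) hr0 N ω).trans ?_).trans_eq ?_
    · exact mul_right_mono (maxIncr_le_ellSquareFn N ω)
    · exact_mod_cast eLpNorm_ennreal_const_mul q 2 (ellSquareFn r d N)
  calc _ ≤ eLpNorm (fun ω => ∑ j ∈ Finset.range N, w j ω
          + ∑ j ∈ Finset.range N, P⁻[w j | ℱ j] ω) q P := by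
        refine eLpNorm_mono_enorm_ae ?_
        filter_upwards [ae_all_iff.2 (ellNorm_davisRemainder_le hr hr' hd)] with ω hω
        simp only [enorm_eq_self, davisVariation]
        rw [← Finset.sum_add_distrib]
        exact Finset.sum_le_sum fun j _ => hω j
    _ ≤ eLpNorm (fun ω => ∑ j ∈ Finset.range N, w j ω) q P
          + eLpNorm (fun ω => ∑ j ∈ Finset.range N, P⁻[w j | ℱ j] ω) q P :=
        eLpNorm_ennreal_add_le hq _
          (Finset.measurable_sum _ fun j _ => measurable_condLExp' _ _ _).aemeasurable
    _ ≤ 2 * eLpNorm (ellSquareFn r d N) q P + q * (2 * eLpNorm (ellSquareFn r d N) q P) := by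
        refine add_le_add hsum ((eLpNorm_sum_condLExp_le ℱ (fun j => (hw j).aemeasurable) hq hq'
          N).trans ?_)
        gcongr
    _ = 2 * (1 + q) * eLpNorm (ellSquareFn r d N) q P := by ring

theorem ellSquareFn_davisMartingale_succ_le [Finite ι] (hr : 1 ≤ r) (hr' : r ≠ ∞)
    (hd : ∀ k, IsMartingaleDiff ℱ P (d k)) (n : ℕ) :
    ∀ᵐ ω ∂P, ellSquareFn r (davisMartingale ℱ P r d) (n + 1) ω ≤ davisBound ℱ P r d n ω := by
  filter_upwards [ellNorm_davisMartingale_le hr hr' hd n] with ω hω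
  exact (ellSquareFn_succ_le hr _ n ω).trans (add_le_add le_rfl hω)

theorem adapted_davisBound [Countable ι] (hd : ∀ k, IsMartingaleDiff ℱ P (d k)) :
    Adapted ℱ (davisBound ℱ P r d) := fun n =>
  (measurable_ellSquareFn (m := ℱ n) fun k j hj =>
    ((isMartingaleDiff_davisMartingale hd k).measurable_succ j).mono (ℱ.mono hj) le_rfl).add
  ((adapted_maxIncr (fun k => (hd k).measurable_succ) n).const_mul 4)

end Davis

section Transform

variable {ι Ω : Type*} {m : MeasurableSpace Ω} {ℱ : Filtration ℕ m} {P : Measure Ω}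
  {q q₀ q₁ r r₀ r₁ : ℝ≥0∞} {d f : ι → ℕ → Ω → ℝ}

/-- The `ℓ^r` norm of the maximal functions `max_{j < n} |f_j|` of a family of processes. -/
noncomputable def ellMaxAbs (r : ℝ≥0∞) (f : ι → ℕ → Ω → ℝ) (n : ℕ) (ω : Ω) : ℝ≥0∞ :=
  ellNorm r fun k => maxAbs (fun j => f k j ω) n

theorem ellMaxAbs_mono (r : ℝ≥0∞) (f : ι → ℕ → Ω → ℝ) (ω : Ω) :
    Monotone fun n => ellMaxAbs r f n ω := fun _ _ h => ellNorm_mono fun _ => maxAbs_mono _ h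

theorem measurable_ellMaxAbs [Countable ι] {n : ℕ} (h : ∀ k, ∀ j < n, Measurable (f k j)) :
    Measurable (ellMaxAbs r f n) :=
  measurable_ellNorm fun k => measurable_maxAbs (h k)

theorem maxPartialSum_mul_le (f d : ℕ → ℝ) (n : ℕ) :
    maxPartialSum (fun j => f j * d j) n ≤ maxAbs f n * ∑ j ∈ Finset.range n, ‖d j‖ₑ := by
  refine (maxPartialSum_le_sum _ _).trans ?_
  rw [Finset.mul_sum]
  refine Finset.sum_le_sum fun j hj => ?_
  rw [enorm_mul]
  gcongr
  exact enorm_le_maxAbs f (Finset.mem_range.1 hj)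

theorem ellSquareFn_mul_le [ENNReal.HolderTriple r₁ r₀ r] (hr₁ : r₁ ≠ 0) (hr₀ : r₀ ≠ 0)
    (hr : r ≠ 0) (f d : ι → ℕ → Ω → ℝ) (n : ℕ) (ω : Ω) :
    ellSquareFn r (f * d) n ω ≤ ellMaxAbs r₁ f n ω * ellSquareFn r₀ d n ω :=
  (ellNorm_mono fun _ => squareFn_mul_le _ _ n).trans (ellNorm_mul_le hr₁ hr₀ hr _ _)

theorem ellMaxSum_mul_le [ENNReal.HolderTriple r₁ r₀ r] (hr₁ : r₁ ≠ 0) (hr₀ : 1 ≤ r₀)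
    (hr : r ≠ 0) (f d : ι → ℕ → Ω → ℝ) (n : ℕ) (ω : Ω) :
    ellMaxSum r (f * d) n ω
      ≤ ellMaxAbs r₁ f n ω * ∑ j ∈ Finset.range n, ellNorm r₀ fun k => ‖d k j ω‖ₑ := by
  refine (ellNorm_mono fun _ => maxPartialSum_mul_le _ _ n).trans ?_
  refine (ellNorm_mul_le hr₁ (zero_lt_one.trans_le hr₀).ne' hr _ _).trans ?_
  exact mul_right_mono (ellNorm_sum_le hr₀ (Finset.range n) fun j k => ‖d k j ω‖ₑ)

theorem measurable_davisVariation [Countable ι] (hd : ∀ k, IsMartingaleDiff ℱ P (d k)) (n : ℕ) :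
    Measurable (davisVariation ℱ P r d n) :=
  Finset.measurable_sum _ fun _ _ => measurable_ellNorm fun k =>
    (((hd k).measurable _).sub ((measurable_davisMartingale (fun k => (hd k).measurable_succ)
      k _).mono (ℱ.le _) le_rfl)).enorm

variable [IsFiniteMeasure P]

theorem eLpNorm_ellMaxSum_mul_davisRemainder_le [Finite ι] [ENNReal.HolderTriple q₁ q₀ q]
    [ENNReal.HolderTriple r₁ r₀ r] (hq₁ : q₁ ≠ 0) (hq₀ : 1 ≤ q₀) (hq₀' : q₀ ≠ ∞) (hr : r ≠ 0)
    (hr₁ : r₁ ≠ 0) (hr₀ : 1 ≤ r₀) (hr₀' : r₀ ≠ ∞) (hd : ∀ k, IsMartingaleDiff ℱ P (d k))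
    (hf : ∀ k j, Measurable (f k j)) (N : ℕ) :
    eLpNorm (ellMaxSum r (f * davisRemainder ℱ P r₀ d) N) q P
      ≤ 2 * (1 + q₀) * (eLpNorm (ellMaxAbs r₁ f N) q₁ P * eLpNorm (ellSquareFn r₀ d N) q₀ P) :=
  calc eLpNorm (ellMaxSum r (f * davisRemainder ℱ P r₀ d) N) q P
      ≤ eLpNorm (fun ω => ellMaxAbs r₁ f N ω * davisVariation ℱ P r₀ d N ω) q P :=
        eLpNorm_mono_enorm fun ω => ellMaxSum_mul_le hr₁ hr₀ hr f _ N ω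
    _ ≤ eLpNorm (ellMaxAbs r₁ f N) q₁ P * eLpNorm (davisVariation ℱ P r₀ d N) q₀ P :=
        eLpNorm_ennreal_mul_le hq₁ (zero_lt_one.trans_le hq₀).ne'
          (measurable_ellMaxAbs fun k j _ => hf k j).aemeasurable
          (measurable_davisVariation hd N).aemeasurable
    _ ≤ eLpNorm (ellMaxAbs r₁ f N) q₁ P * (2 * (1 + q₀) * eLpNorm (ellSquareFn r₀ d N) q₀ P) := by
        gcongr
        exact eLpNorm_davisVariation_le hr₀ hr₀' hd hq₀ hq₀' N
    _ = _ := by ring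

theorem eLpNorm_mul_davisControl_le [Finite ι] [ENNReal.HolderTriple q₁ q₀ q]
    (hq₁ : q₁ ≠ 0) (hq₀ : 1 ≤ q₀) (hq₀' : q₀ ≠ ∞) (hr₀ : 1 ≤ r₀) (hr₀' : r₀ ≠ ∞)
    (hd : ∀ k, IsMartingaleDiff ℱ P (d k)) (hf : ∀ k j, Measurable (f k j)) (N : ℕ) :
    eLpNorm (fun ω => ellMaxAbs r₁ f N ω
        * (5 * ellSquareFn r₀ d N ω + davisVariation ℱ P r₀ d N ω)) q P
      ≤ (5 + 2 * (1 + q₀))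
        * (eLpNorm (ellMaxAbs r₁ f N) q₁ P * eLpNorm (ellSquareFn r₀ d N) q₀ P) := by
  have hsquare : Measurable fun ω => 5 * ellSquareFn r₀ d N ω :=
    (measurable_ellSquareFn fun k j _ => (hd k).measurable j).const_mul 5
  have hvar := measurable_davisVariation (r := r₀) hd N
  calc _ ≤ eLpNorm (ellMaxAbs r₁ f N) q₁ P
        * eLpNorm (fun ω => 5 * ellSquareFn r₀ d N ω + davisVariation ℱ P r₀ d N ω) q₀ P :=
        eLpNorm_ennreal_mul_le hq₁ (zero_lt_one.trans_le hq₀).ne'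
          (measurable_ellMaxAbs fun k j _ => hf k j).aemeasurable (hsquare.add hvar).aemeasurable
    _ ≤ eLpNorm (ellMaxAbs r₁ f N) q₁ P * (5 * eLpNorm (ellSquareFn r₀ d N) q₀ P
          + 2 * (1 + q₀) * eLpNorm (ellSquareFn r₀ d N) q₀ P) := by
        gcongr
        refine (eLpNorm_ennreal_add_le hq₀ _ hvar.aemeasurable).trans ?_
        refine add_le_add (le_of_eq ?_) (eLpNorm_davisVariation_le hr₀ hr₀' hd hq₀ hq₀' N)
        exact_mod_cast eLpNorm_ennreal_const_mul q₀ 5 (ellSquareFn r₀ d N)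
    _ = _ := by ring

end Transform

theorem exists_eLpNorm_ellMaxSum_mul_davisMartingale_le_of_weakTypeBDG.{u, v}
    {q q₀ q₁ r r₀ r₁ : ℝ≥0∞} [ENNReal.HolderTriple q₁ q₀ q] [ENNReal.HolderTriple r₁ r₀ r]
    (hq : q ≠ 0) (hq' : q ≠ ∞) (hq₁ : q₁ ≠ 0) (hq₀ : 1 ≤ q₀) (hq₀' : q₀ ≠ ∞)
    (hr : 1 ≤ r) (hr' : r ≠ ∞) (hr₁ : r₁ ≠ 0) (hr₀ : 1 ≤ r₀) (hr₀' : r₀ ≠ ∞) (C : ℝ≥0) :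
    ∃ C' : ℝ≥0, ∀ (Ω : Type u) {m : MeasurableSpace Ω} (P : Measure Ω) [IsFiniteMeasure P]
      (ℱ : Filtration ℕ m) (ι : Type v) [Finite ι], WeakTypeBDG ℱ P ι r C →
      ∀ d f : ι → ℕ → Ω → ℝ, (∀ k, IsMartingaleDiff ℱ P (d k)) → (∀ k, Adapted ℱ (f k)) → ∀ N,
      eLpNorm (ellMaxSum r (f * davisMartingale ℱ P r₀ d) N) q P
        ≤ C' * ((5 + 2 * (1 + q₀))
          * (eLpNorm (ellMaxAbs r₁ f N) q₁ P * eLpNorm (ellSquareFn r₀ d N) q₀ P)) := by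
  obtain ⟨C', hC'⟩ := exists_eLpNorm_ellMaxSum_le_of_weakTypeBDG.{u, v} hr hr' hq hq' C
  refine ⟨C', fun Ω m P _ ℱ ι _ hC d f hd hf N => ?_⟩
  have hf' : ∀ k j, Measurable (f k j) := fun k j => (hf k j).mono (ℱ.le j) le_rfl
  have hmart := isMartingaleDiff_davisMartingale (r := r₀) hd
  have hadapted : Adapted ℱ fun n ω => ellMaxAbs r₁ f (n + 1) ω * davisBound ℱ P r₀ d n ω :=
    fun n => (measurable_ellMaxAbs (m := ℱ n) fun k j hj => (hf k j).mono
      (ℱ.mono (Nat.lt_succ_iff.1 hj)) le_rfl).mul (adapted_davisBound hd n)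
  have hbound : ∀ n, ∀ᵐ ω ∂P, ellSquareFn r (f * davisMartingale ℱ P r₀ d) (n + 1) ω
      ≤ ellMaxAbs r₁ f (n + 1) ω * davisBound ℱ P r₀ d n ω := fun n => by
    filter_upwards [ellSquareFn_davisMartingale_succ_le hr₀ hr₀' hd n] with ω hω
    exact (ellSquareFn_mul_le hr₁ (zero_lt_one.trans_le hr₀).ne' (zero_lt_one.trans_le hr).ne'
      f _ (n + 1) ω).trans (by gcongr)
  refine (hC' Ω P ℱ ι hC (f * davisMartingale ℱ P r₀ d)
    (fun k => (hmart k).isLocalMartingaleDiff_mul (hf k)) _ hadapted hbound N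
    (fun ω => ellMaxAbs r₁ f N ω * (5 * ellSquareFn r₀ d N ω + davisVariation ℱ P r₀ d N ω))
    ?_ (fun ω => ?_) fun n hn ω => ?_).trans ?_
  · exact (measurable_ellMaxAbs fun k j _ => hf' k j).mul
      (((measurable_ellSquareFn fun k j _ => (hd k).measurable j).const_mul 5).add
        (measurable_davisVariation hd N))
  · exact ENNReal.mul_ne_top (ellNorm_ne_top fun k => maxAbs_ne_top _ _) <| ENNReal.add_ne_top.2
      ⟨ENNReal.mul_ne_top (by norm_num) (ellNorm_ne_top fun k => squareFn_ne_top _ _),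
        ENNReal.sum_ne_top.2 fun j _ => ellNorm_ne_top fun k => enorm_ne_top⟩
  · exact mul_le_mul' (ellMaxAbs_mono r₁ f ω hn) (davisBound_le hr₀ hn.le ω)
  · gcongr
    exact eLpNorm_mul_davisControl_le hq₁ hq₀ hq₀' hr₀ hr₀' hd hf' N

theorem exists_eLpNorm_ellMaxSum_mul_le_of_weakTypeBDG.{u, v}
    {q q₀ q₁ r r₀ r₁ : ℝ≥0∞} [ENNReal.HolderTriple q₁ q₀ q] [ENNReal.HolderTriple r₁ r₀ r]
    (hq : q ≠ 0) (hq' : q ≠ ∞) (hq₁ : q₁ ≠ 0) (hq₀ : 1 ≤ q₀) (hq₀' : q₀ ≠ ∞)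
    (hr : 1 ≤ r) (hr' : r ≠ ∞) (hr₁ : r₁ ≠ 0) (hr₀ : 1 ≤ r₀) (hr₀' : r₀ ≠ ∞) (C : ℝ≥0) :
    ∃ C' : ℝ≥0, ∀ (Ω : Type u) {m : MeasurableSpace Ω} (P : Measure Ω) [IsFiniteMeasure P]
      (ℱ : Filtration ℕ m) (ι : Type v) [Finite ι], WeakTypeBDG ℱ P ι r C →
      ∀ d f : ι → ℕ → Ω → ℝ, (∀ k, IsMartingaleDiff ℱ P (d k)) → (∀ k, Adapted ℱ (f k)) → ∀ N,
      eLpNorm (ellMaxSum r (f * d) N) q P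
        ≤ C' * (eLpNorm (ellMaxAbs r₁ f N) q₁ P * eLpNorm (ellSquareFn r₀ d N) q₀ P) := by
  obtain ⟨C₁, hC₁⟩ := exists_eLpNorm_ellMaxSum_mul_davisMartingale_le_of_weakTypeBDG.{u, v}
    (r₁ := r₁) hq hq' hq₁ hq₀ hq₀' hr hr' hr₁ hr₀ hr₀' C
  set A : ℝ≥0∞ := 2 * (1 + q₀)
  have hA : A ≠ ∞ := ENNReal.mul_ne_top (by norm_num) (ENNReal.add_ne_top.2 ⟨by norm_num, hq₀'⟩)
  have hK : ENNReal.LpAddConst q * (C₁ * (5 + A) + A) ≠ ∞ :=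
    ENNReal.mul_ne_top (ENNReal.LpAddConst_lt_top q).ne (ENNReal.add_ne_top.2
      ⟨ENNReal.mul_ne_top (by simp) (ENNReal.add_ne_top.2 ⟨by norm_num, hA⟩), hA⟩)
  refine ⟨(ENNReal.LpAddConst q * (C₁ * (5 + A) + A)).toNNReal, ?_⟩
  intro Ω m P _ ℱ ι _ hC d f hd hf N
  rw [ENNReal.coe_toNNReal hK]
  have hf' : ∀ k j, Measurable (f k j) := fun k j => (hf k j).mono (ℱ.le j) le_rfl
  set p := davisMartingale ℱ P r₀ d
  have hp : ∀ k j, Measurable (p k j) := fun k j =>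
    (isMartingaleDiff_davisMartingale hd k).measurable j
  have hsplit : f * d = f * p + f * davisRemainder ℱ P r₀ d := by
    rw [← mul_add]
    exact congrArg _ (add_sub_cancel p d).symm
  set B := eLpNorm (ellMaxAbs r₁ f N) q₁ P * eLpNorm (ellSquareFn r₀ d N) q₀ P
  calc eLpNorm (ellMaxSum r (f * d) N) q P
      ≤ eLpNorm (ellMaxSum r (f * p) N + ellMaxSum r (f * davisRemainder ℱ P r₀ d) N) q P := by
        rw [hsplit]
        exact eLpNorm_mono_enorm fun ω => ellMaxSum_add_le hr _ _ N ω
    _ ≤ ENNReal.LpAddConst q * (eLpNorm (ellMaxSum r (f * p) N) q P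
          + eLpNorm (ellMaxSum r (f * davisRemainder ℱ P r₀ d) N) q P) :=
        eLpNorm_add_le'
          (measurable_ellMaxSum fun k j _ => (hf' k j).mul (hp k j)).aestronglyMeasurable
          (measurable_ellMaxSum fun k j _ => (hf' k j).mul
            (((hd k).measurable j).sub (hp k j))).aestronglyMeasurable q
    _ ≤ ENNReal.LpAddConst q * (C₁ * ((5 + A) * B) + A * B) := by
        gcongr
        · exact hC₁ Ω P ℱ ι hC d f hd hf N
        · exact eLpNorm_ellMaxSum_mul_davisRemainder_le hq₁ hq₀ hq₀' (zero_lt_one.trans_le hr).ne'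
            hr₁ hr₀ hr₀' hd hf' N
    _ = _ := by ring

theorem exists_lintegral_maxPartialSum_rpow_le.{u} {r : ℝ≥0∞} (hr : 1 ≤ r) (hr' : r ≠ ∞) :
    ∃ C : ℝ≥0, ∀ (Ω : Type u) {m : MeasurableSpace Ω} (P : Measure Ω) [IsFiniteMeasure P]
      (ℱ : Filtration ℕ m) (d : ℕ → Ω → ℝ), IsMartingaleDiff ℱ P d → ∀ n,
      ∫⁻ ω, maxPartialSum (fun j => d j ω) n ^ r.toReal ∂P
        ≤ C * ∫⁻ ω, squareFn (fun j => d j ω) n ^ r.toReal ∂P := by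
  have hr0 : r ≠ 0 := (zero_lt_one.trans_le hr).ne'
  obtain ⟨C, hC⟩ := exists_eLpNorm_ellMaxSum_mul_le_of_weakTypeBDG.{u, 0} (q := r) (q₀ := r)
    (q₁ := ∞) (r := 2) (r₀ := 2) (r₁ := ∞) hr0 hr' (by simp) hr hr' (by norm_num) (by norm_num)
    (by norm_num) (by norm_num) (by norm_num) 1
  refine ⟨C ^ r.toReal, fun Ω m P _ ℱ d hd n => ?_⟩
  have hone : eLpNorm (ellMaxAbs ∞ (1 : Unit → ℕ → Ω → ℝ) n) ∞ P ≤ 1 := by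
    rw [eLpNorm_exponent_top]
    refine eLpNormEssSup_le_of_ae_enorm_bound (.of_forall fun ω => ?_)
    rw [enorm_eq_self, ellMaxAbs, ellNorm_unique (by simp)]
    exact Finset.sup_le fun j _ => by simp
  have h := hC Ω P ℱ Unit weakTypeBDG_two_unit (fun _ => d) 1 (fun _ => hd)
    (fun _ _ => measurable_const) n
  have hscalar : eLpNorm (fun ω => maxPartialSum (fun j => d j ω) n) r P
      ≤ C * eLpNorm (fun ω => squareFn (fun j => d j ω) n) r P := by
    have hmax : ellMaxSum 2 (fun _ : Unit => d) n = fun ω => maxPartialSum (fun j => d j ω) n :=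
      funext fun ω => ellNorm_unique two_ne_zero _
    have hsquare : ellSquareFn 2 (fun _ : Unit => d) n = fun ω => squareFn (fun j => d j ω) n :=
      funext fun ω => ellNorm_unique two_ne_zero _
    rw [one_mul, hmax, hsquare] at h
    exact h.trans (mul_right_mono (mul_le_of_le_one_left' hone))
  rw [← eLpNorm_ennreal_rpow hr0 hr', ← eLpNorm_ennreal_rpow hr0 hr',
    ENNReal.coe_rpow_of_nonneg _ ENNReal.toReal_nonneg,
    ← ENNReal.mul_rpow_of_nonneg _ _ ENNReal.toReal_nonneg]
  gcongr

theorem exists_weakTypeBDG.{u, v} {r : ℝ≥0∞} (hr : 1 ≤ r) (hr' : r ≠ ∞) :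
    ∃ C : ℝ≥0, ∀ (Ω : Type u) {m : MeasurableSpace Ω} (P : Measure Ω) [IsFiniteMeasure P]
      (ℱ : Filtration ℕ m) (ι : Type v) [Finite ι], WeakTypeBDG ℱ P ι r C := by
  have hr0 : r ≠ 0 := (zero_lt_one.trans_le hr).ne'
  obtain ⟨C, hC⟩ := exists_lintegral_maxPartialSum_rpow_le.{u} hr hr'
  refine ⟨C, fun Ω m P _ ℱ ι _ d hd _ n l => ?_⟩
  have := Fintype.ofFinite ι
  have hmeas : ∀ k j, Measurable (d k j) := fun k => (hd k).measurable
  calc (l : ℝ≥0∞) ^ r.toReal * P {ω | l < ellMaxSum r d n ω}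
      ≤ (l : ℝ≥0∞) ^ r.toReal * P {ω | (l : ℝ≥0∞) ^ r.toReal ≤ ellMaxSum r d n ω ^ r.toReal} := by
        gcongr with ω
        exact fun hω => ENNReal.rpow_le_rpow hω.le ENNReal.toReal_nonneg
    _ ≤ ∫⁻ ω, ellMaxSum r d n ω ^ r.toReal ∂P :=
        mul_meas_ge_le_lintegral ((measurable_ellMaxSum fun k j _ => hmeas k j).pow_const _) _
    _ = ∑ k, ∫⁻ ω, maxPartialSum (fun j => d k j ω) n ^ r.toReal ∂P := by
        simp_rw [ellMaxSum, ellNorm_rpow hr0 hr']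
        exact lintegral_finsetSum _ fun k _ =>
          (measurable_maxPartialSum fun j _ => hmeas k j).pow_const _
    _ ≤ ∑ k, C * ∫⁻ ω, squareFn (fun j => d k j ω) n ^ r.toReal ∂P :=
        Finset.sum_le_sum fun k _ => hC Ω P ℱ (d k) (hd k) n
    _ = C * ∫⁻ ω, ellSquareFn r d n ω ^ r.toReal ∂P := by
        simp_rw [ellSquareFn, ellNorm_rpow hr0 hr']
        rw [← Finset.mul_sum, lintegral_finsetSum _ fun k _ =>
          (measurable_squareFn fun j _ => hmeas k j).pow_const _]

theorem exists_eLpNorm_ellMaxSum_mul_le.{u, v}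
    {q q₀ q₁ r r₀ r₁ : ℝ≥0∞} [ENNReal.HolderTriple q₁ q₀ q] [ENNReal.HolderTriple r₁ r₀ r]
    (hq : q ≠ 0) (hq' : q ≠ ∞) (hq₁ : q₁ ≠ 0) (hq₀ : 1 ≤ q₀) (hq₀' : q₀ ≠ ∞)
    (hr : 1 ≤ r) (hr' : r ≠ ∞) (hr₁ : r₁ ≠ 0) (hr₀ : 1 ≤ r₀) (hr₀' : r₀ ≠ ∞) :
    ∃ C : ℝ≥0, ∀ (Ω : Type u) {m : MeasurableSpace Ω} (P : Measure Ω) [IsFiniteMeasure P]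
      (ℱ : Filtration ℕ m) (ι : Type v) [Finite ι] (d f : ι → ℕ → Ω → ℝ),
      (∀ k, IsMartingaleDiff ℱ P (d k)) → (∀ k, Adapted ℱ (f k)) → ∀ N,
      eLpNorm (ellMaxSum r (f * d) N) q P
        ≤ C * (eLpNorm (ellMaxAbs r₁ f N) q₁ P * eLpNorm (ellSquareFn r₀ d N) q₀ P) := by
  obtain ⟨C₁, hC₁⟩ := exists_weakTypeBDG.{u, v} hr hr'
  obtain ⟨C₂, hC₂⟩ := exists_eLpNorm_ellMaxSum_mul_le_of_weakTypeBDG.{u, v} (r₁ := r₁) hq hq' hq₁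
    hq₀ hq₀' hr hr' hr₁ hr₀ hr₀' C₁
  exact ⟨C₂, fun Ω _ P _ ℱ ι _ => hC₂ Ω P ℱ ι (hC₁ Ω P ℱ ι)⟩

section Pathwise

theorem natCast_succ_le_iff {b : WithTop ℕ} {j : ℕ} :
    ((j + 1 : ℕ) : WithTop ℕ) ≤ b ↔ (j : WithTop ℕ) < b :=
  ENat.natCast_add_one_le_iff

theorem lt_natCast_succ_iff {a : WithTop ℕ} {j : ℕ} :
    a < ((j + 1 : ℕ) : WithTop ℕ) ↔ a ≤ (j : WithTop ℕ) := by
  rw [← not_iff_not, not_le, not_lt, natCast_succ_le_iff]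

theorem exists_eq_natCast_of_le {a : WithTop ℕ} {s : ℕ} (h : a ≤ (s : WithTop ℕ)) :
    ∃ i ≤ s, a = (i : WithTop ℕ) := by
  lift a to ℕ using ne_top_of_le_ne_top (WithTop.natCast_ne_top s) h
  exact ⟨a, (Nat.cast_le (α := WithTop ℕ)).1 h, rfl⟩

/-- The times `j` with `a ≤ j < b`; these index the increments `dg_{j+1}` of a process `g` in the
stochastic interval `(a, b]`. -/
def activeSet (a b : WithTop ℕ) : Set ℕ := {j | a ≤ (j : WithTop ℕ) ∧ (j : WithTop ℕ) < b}

/-- The increments of `g` in the stochastic interval `(a, b]`, extended by zero; the `j`-th one is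
`dg_{j+1}`. -/
noncomputable def localIncr (g : ℕ → ℝ) (a b : WithTop ℕ) : ℕ → ℝ :=
  (activeSet a b).indicator fun j => diff g (j + 1)

/-- The integrand `F_{a, j}` on the stochastic interval `[a, b)`, extended by zero. -/
noncomputable def localIntegrand (F : ℕ → ℕ → ℝ) (a b : WithTop ℕ) : ℕ → ℝ :=
  (activeSet a b).indicator (F (a.untopD 0))

variable (F : ℕ → ℕ → ℝ) (g : ℕ → ℝ)

theorem paraprod_eq_sum_range {s t : ℕ} (h : s ≤ t) :
    paraprod F g s t = ∑ j ∈ Finset.range t, if s ≤ j then F s j * diff g (j + 1) else 0 := by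
  induction t, h using Nat.le_induction with
  | base =>
    rw [Finset.sum_eq_zero fun j hj => if_neg (not_le.2 (Finset.mem_range.1 hj))]
    simp [paraprod]
  | succ t h ih =>
    rw [Finset.sum_range_succ, ← ih, if_pos h, paraprod, paraprod,
      Finset.sum_Ioc_succ_top h, Nat.add_sub_cancel]

theorem paraprod_eq_sum_local {a b : WithTop ℕ} {t : ℕ}
    (hat : a ≤ (t : WithTop ℕ)) (htb : (t : WithTop ℕ) ≤ b) :
    paraprod F g (a.untopD 0) t
      = ∑ j ∈ Finset.range t, localIntegrand F a b j * localIncr g a b j := by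
  obtain ⟨s, hst, rfl⟩ := exists_eq_natCast_of_le hat
  have huntop : (s : WithTop ℕ).untopD 0 = s := rfl
  rw [huntop, paraprod_eq_sum_range F g hst]
  refine Finset.sum_congr rfl fun j hj => ?_
  have hjb : (j : WithTop ℕ) < b :=
    (Nat.cast_lt.2 (Finset.mem_range.1 hj)).trans_le htb
  by_cases hsj : s ≤ j <;> simp [localIntegrand, localIncr, activeSet, hjb, hsj, huntop]

theorem supParaprodFrom_eq_iSup_maxPartialSum (a b : WithTop ℕ) :
    supParaprodFrom F g a b
      = ⨆ N, maxPartialSum (fun j => localIntegrand F a b j * localIncr g a b j) N := by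
  refine le_antisymm (iSup₂_le fun t ht => le_iSup_of_le t ?_)
    (iSup_le fun N => maxPartialSum_le fun t _ => ?_)
  · rw [paraprod_eq_sum_local F g ht.1 ht.2]
    exact enorm_sum_le_maxPartialSum _ le_rfl
  · induction t with
    | zero => simp
    | succ t ih =>
      by_cases ht : t ∈ activeSet a b
      · have hat : a ≤ ((t + 1 : ℕ) : WithTop ℕ) := (lt_natCast_succ_iff.2 ht.1).le
        have htb : ((t + 1 : ℕ) : WithTop ℕ) ≤ b := natCast_succ_le_iff.2 ht.2
        rw [← paraprod_eq_sum_local F g hat htb]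
        exact le_iSup₂_of_le (f := fun t _ => ‖paraprod F g (a.untopD 0) t‖ₑ) _ ⟨hat, htb⟩ le_rfl
      · rw [Finset.sum_range_succ, localIncr, Set.indicator_of_notMem ht, mul_zero, add_zero]
        exact ih (by omega)

theorem maxAbs_localIntegrand_le (a b : WithTop ℕ) (N : ℕ) :
    maxAbs (localIntegrand F a b) N ≤ supFrom F a b := by
  refine Finset.sup_le fun j _ => ?_
  by_cases h : j ∈ activeSet a b
  · rw [localIntegrand, Set.indicator_of_mem h]
    exact le_iSup₂_of_le j h le_rfl
  · simp [localIntegrand, h]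

theorem squareFn_localIncr_le (a b : WithTop ℕ) (N : ℕ) :
    squareFn (localIncr g a b) N ≤ sqFun g a b := by
  rw [squareFn, sqFun]
  gcongr
  let S : Set ℕ := {j | a < (j : WithTop ℕ) ∧ (j : WithTop ℕ) ≤ b}
  have hshift : ∀ j, ‖localIncr g a b j‖ₑ ^ (2 : ℝ)
      = S.indicator (fun i => ‖diff g i‖ₑ ^ 2) (j + 1) := fun j => by
    by_cases h : j ∈ activeSet a b
    · have hS : j + 1 ∈ S := ⟨lt_natCast_succ_iff.2 h.1, natCast_succ_le_iff.2 h.2⟩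
      rw [Set.indicator_of_mem hS, localIncr, Set.indicator_of_mem h, ENNReal.rpow_two]
    · have hS : j + 1 ∉ S := fun h' => h ⟨lt_natCast_succ_iff.1 h'.1, natCast_succ_le_iff.1 h'.2⟩
      rw [Set.indicator_of_notMem hS, localIncr, Set.indicator_of_notMem h]
      simp
  calc ∑ j ∈ Finset.range N, ‖localIncr g a b j‖ₑ ^ (2 : ℝ)
      = ∑ j ∈ Finset.range N, S.indicator (fun i => ‖diff g i‖ₑ ^ 2) (j + 1) :=
        Finset.sum_congr rfl fun j _ => hshift j
    _ ≤ ∑' j, S.indicator (fun i => ‖diff g i‖ₑ ^ 2) (j + 1) := ENNReal.sum_le_tsum _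
    _ ≤ ∑' j, S.indicator (fun i => ‖diff g i‖ₑ ^ 2) j :=
        ENNReal.tsum_comp_le_tsum_of_injective (add_left_injective 1) _
    _ = ∑' j : S, ‖diff g j‖ₑ ^ 2 := (tsum_subtype S fun i => ‖diff g i‖ₑ ^ 2).symm

theorem supFrom_le_supTwo (a b : WithTop ℕ) : supFrom F a b ≤ supTwo F a b := by
  refine iSup₂_le fun t ⟨hat, htb⟩ => ?_
  obtain ⟨i, hit, rfl⟩ := exists_eq_natCast_of_le hat
  exact le_iSup_of_le i (le_iSup₂_of_le t ⟨le_rfl, hit, htb.le⟩ le_rfl)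

theorem paraprod_eq_sub_sub_paraprod_deltaFst {a s t : ℕ} (has : a ≤ s) (hst : s ≤ t) :
    paraprod F g s t
      = paraprod F g a t - paraprod F g a s - paraprod (deltaFst a F) g s t := by
  have hsplit := Finset.sum_Ioc_consecutive (fun j => F a (j - 1) * diff g j) has hst
  simp only [paraprod, deltaFst, sub_mul, Finset.sum_sub_distrib]
  linarith

theorem supParaprod_le (a b : WithTop ℕ) :
    supParaprod F g a b
      ≤ supParaprod (deltaFst (a.untopD 0) F) g a b + 2 * supParaprodFrom F g a b := by
  refine iSup_le fun s => iSup₂_le fun t ⟨has, hst, htb⟩ => ?_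
  have hst' : (s : WithTop ℕ) ≤ t := Nat.cast_le.2 hst.le
  have hδ : ‖paraprod (deltaFst (a.untopD 0) F) g s t‖ₑ
      ≤ supParaprod (deltaFst (a.untopD 0) F) g a b :=
    le_iSup_of_le s (le_iSup₂_of_le (f := fun t _ => ‖paraprod (deltaFst (a.untopD 0) F) g s t‖ₑ)
      t ⟨has, hst, htb⟩ le_rfl)
  have hfrom : ∀ u : ℕ, a ≤ u → (u : WithTop ℕ) ≤ b →
      ‖paraprod F g (a.untopD 0) u‖ₑ ≤ supParaprodFrom F g a b := fun u hau hub =>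
    le_iSup₂_of_le (f := fun u _ => ‖paraprod F g (a.untopD 0) u‖ₑ) u ⟨hau, hub⟩ le_rfl
  have has' : a.untopD 0 ≤ s := by
    obtain ⟨i, his, rfl⟩ := exists_eq_natCast_of_le has
    exact his
  rw [paraprod_eq_sub_sub_paraprod_deltaFst F g has' hst.le, add_comm, two_mul]
  exact enorm_sub_le.trans (add_le_add (enorm_sub_le.trans
    (add_le_add (hfrom t (has.trans hst') htb) (hfrom s has (hst'.trans htb)))) hδ)

end Pathwise

section Exhaustion

theorem iSup_rpow {κ : Type*} (x : κ → ℝ≥0∞) {q : ℝ} (hq : 0 < q) :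
    (⨆ i, x i) ^ q = ⨆ i, x i ^ q :=
  (ENNReal.orderIsoRpow q hq).map_iSup x

theorem ellNorm_iSup_le {ι : Type*} {r : ℝ≥0∞} (hr : r ≠ 0) (hr' : r ≠ ∞)
    {x : ι → ℕ → ℝ≥0∞} (hx : ∀ k, Monotone (x k)) :
    ellNorm r (fun k => ⨆ N, x k N)
      ≤ ⨆ p : Finset ι × ℕ, ellNorm r fun k : p.1 => x k p.2 := by
  have hr0 := ENNReal.toReal_pos hr hr'
  simp only [ellNorm, if_neg hr']
  rw [← iSup_rpow _ (by positivity)]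
  gcongr
  simp_rw [iSup_rpow _ hr0, ENNReal.tsum_eq_iSup_sum (f := fun k => ⨆ N, x k N ^ r.toReal)]
  refine iSup_le fun s => ?_
  rw [ENNReal.finsetSum_iSup_of_monotone fun k _ _ h => ENNReal.rpow_le_rpow (hx k h) hr0.le]
  refine iSup_le fun N => le_iSup_of_le (s, N) ?_
  rw [tsum_fintype, Finset.sum_coe_sort s fun k => x k N ^ r.toReal]

theorem eLpNorm_iSup_le {α κ : Type*} [Countable κ] {_ : MeasurableSpace α} {μ : Measure α}
    {q : ℝ≥0∞} (hq : q ≠ 0) (hq' : q ≠ ∞) {y : κ → α → ℝ≥0∞} (hy : ∀ p, Measurable (y p))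
    (hdir : Directed (· ≤ ·) y) :
    eLpNorm (fun a => ⨆ p, y p a) q μ ≤ ⨆ p, eLpNorm (y p) q μ := by
  have hq0 := ENNReal.toReal_pos hq hq'
  rw [← ENNReal.rpow_le_rpow_iff hq0, iSup_rpow _ hq0]
  simp only [eLpNorm_ennreal_rpow hq hq', iSup_rpow _ hq0]
  refine (lintegral_iSup_directed_of_measurable (fun p => (hy p).pow_const _) fun p p' => ?_).le
  obtain ⟨p'', hp, hp'⟩ := hdir p p'
  exact ⟨p'', fun a => ENNReal.rpow_le_rpow (hp a) hq0.le,
    fun a => ENNReal.rpow_le_rpow (hp' a) hq0.le⟩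

theorem eLpNorm_ellNorm_iSup_le {ι Ω : Type*} [Countable ι] {_ : MeasurableSpace Ω}
    {P : Measure Ω} {q r : ℝ≥0∞} (hq : q ≠ 0) (hq' : q ≠ ∞) (hr : r ≠ 0) (hr' : r ≠ ∞)
    {x : ι → ℕ → Ω → ℝ≥0∞} (hx : ∀ k N, Measurable (x k N))
    (hmono : ∀ k ω, Monotone fun N => x k N ω) :
    eLpNorm (fun ω => ellNorm r fun k => ⨆ N, x k N ω) q P
      ≤ ⨆ p : Finset ι × ℕ, eLpNorm (fun ω => ellNorm r fun k : p.1 => x k p.2 ω) q P := by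
  refine (eLpNorm_mono_enorm fun ω => ellNorm_iSup_le hr hr' fun k => hmono k ω).trans
    (eLpNorm_iSup_le hq hq' (fun p => measurable_ellNorm fun k => hx k p.2) ?_)
  classical
  refine Monotone.directed_le fun p p' h ω => ?_
  exact (ellNorm_mono fun k : p.1 => hmono k ω h.2).trans
    (ellNorm_comp_le_of_injective (Set.inclusion_injective h.1) fun k : p'.1 => x k p'.2 ω)

end Exhaustion

section Localization

variable {Ω : Type*} {m : MeasurableSpace Ω} {ℱ : Filtration ℕ m} {P : Measure Ω}
  {g : ℕ → Ω → ℝ} {F : ℕ → ℕ → Ω → ℝ} {τ' τ : Ω → WithTop ℕ}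

theorem isMartingaleDiff_diff (hg : Martingale g ℱ P) :
    IsMartingaleDiff ℱ P fun j ω => diff (fun n => g n ω) (j + 1) where
  measurable_succ j := (hg.1 (j + 1)).measurable.sub
    ((hg.1 j).measurable.mono (ℱ.mono j.le_succ) le_rfl)
  integrable j := (hg.integrable (j + 1)).sub (hg.integrable j)
  condExp_eq_zero j := by
    refine (condExp_sub (hg.integrable (j + 1)) (hg.integrable j) (ℱ j)).trans ?_
    filter_upwards [hg.2 j (j + 1) j.le_succ, hg.2 j j le_rfl] with ω hsucc hself
    simp [hsucc, hself]

theorem measurableSet_mem_activeSet (hτ' : IsStoppingTime ℱ τ') (hτ : IsStoppingTime ℱ τ)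
    (j : ℕ) : MeasurableSet[ℱ j] {ω | j ∈ activeSet (τ' ω) (τ ω)} :=
  (hτ'.measurableSet_le j).inter (hτ.measurableSet_gt j)

theorem isMartingaleDiff_localIncr (hg : Martingale g ℱ P)
    (hτ' : IsStoppingTime ℱ τ') (hτ : IsStoppingTime ℱ τ) :
    IsMartingaleDiff ℱ P fun j ω => localIncr (fun n => g n ω) (τ' ω) (τ ω) j :=
  (isMartingaleDiff_diff hg).indicator (measurableSet_mem_activeSet hτ' hτ)

theorem adapted_localIntegrand (hF : AdaptedTwo ℱ F)
    (hτ' : IsStoppingTime ℱ τ') (hτ : IsStoppingTime ℱ τ) :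
    Adapted ℱ fun j ω => localIntegrand (fun s t => F s t ω) (τ' ω) (τ ω) j := fun j => by
  let A : Set Ω := {ω | j ∈ activeSet (τ' ω) (τ ω)}
  let f : WithTop ℕ → Ω → ℝ := fun a => F (min (a.untopD 0) j) j
  have heq : (fun ω => localIntegrand (fun s t => F s t ω) (τ' ω) (τ ω) j)
      = A.indicator fun ω => f (min (τ' ω) j) ω := funext fun ω => by
    by_cases hω : j ∈ activeSet (τ' ω) (τ ω)
    · obtain ⟨i, hij, hi⟩ := exists_eq_natCast_of_le hω.1
      rw [localIntegrand, Set.indicator_of_mem hω, Set.indicator_of_mem (show ω ∈ A from hω),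
        min_eq_left hω.1, hi]
      exact congrArg (fun a => F a j ω) (min_eq_left hij).symm
    · rw [localIntegrand, Set.indicator_of_notMem hω, Set.indicator_of_notMem (show ω ∉ A from hω)]
  simp only [heq]
  refine Measurable.indicator ?_ (measurableSet_mem_activeSet hτ' hτ j)
  have hmin : Measurable[ℱ j] fun ω => min (τ' ω) (j : WithTop ℕ) :=
    (hτ'.min_const j).measurable_of_le fun _ => min_le_right _ _
  have hf : Measurable[(ℱ j).prod inferInstance] fun p : Ω × WithTop ℕ => f p.2 p.1 :=
    measurable_from_prod_countable_left (m := ℱ j) fun a =>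
      hF _ j (min_le_right (a.untopD 0) j)
  exact hf.comp (measurable_id.prodMk hmin)

theorem measurable_localIntegrand_mul_localIncr (hg : Martingale g ℱ P) (hF : AdaptedTwo ℱ F)
    (hτ' : IsStoppingTime ℱ τ') (hτ : IsStoppingTime ℱ τ) (j : ℕ) :
    Measurable fun ω => localIntegrand (fun s t => F s t ω) (τ' ω) (τ ω) j
      * localIncr (fun n => g n ω) (τ' ω) (τ ω) j :=
  ((adapted_localIntegrand hF hτ' hτ j).mono (ℱ.le j) le_rfl).mul
    ((isMartingaleDiff_localIncr hg hτ' hτ).measurable j)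

theorem measurable_supParaprodFrom (hg : Martingale g ℱ P) (hF : AdaptedTwo ℱ F)
    (hτ' : IsStoppingTime ℱ τ') (hτ : IsStoppingTime ℱ τ) :
    Measurable fun ω =>
      supParaprodFrom (fun s t => F s t ω) (fun n => g n ω) (τ' ω) (τ ω) := by
  simp only [supParaprodFrom_eq_iSup_maxPartialSum]
  exact Measurable.iSup fun N => measurable_maxPartialSum fun j _ =>
    measurable_localIntegrand_mul_localIncr hg hF hτ' hτ j

end Localization

section Estimates

theorem exists_eLpNorm_supParaprodFrom_le.{u, v} {q q₀ q₁ r r₀ r₁ : ℝ≥0∞}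
    [ENNReal.HolderTriple q₁ q₀ q] [ENNReal.HolderTriple r₁ r₀ r]
    (hq : q ≠ 0) (hq₁ : q₁ ≠ 0) (hq₀ : 1 ≤ q₀) (hq₀' : q₀ ≠ ∞) (hr : 1 ≤ r) (hr₀' : r₀ ≠ ∞) :
    ∃ C : ℝ≥0, ∀ (Ω : Type u) {m : MeasurableSpace Ω} (P : Measure Ω) [IsFiniteMeasure P]
      (ℱ : Filtration ℕ m) (ι : Type v) [Countable ι] (g : ι → ℕ → Ω → ℝ)
      (F : ι → ℕ → ℕ → Ω → ℝ) (τ' τ : ι → Ω → WithTop ℕ),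
      (∀ k, Martingale (g k) ℱ P) → (∀ k, AdaptedTwo ℱ (F k)) →
      (∀ k, IsStoppingTime ℱ (τ' k)) → (∀ k, IsStoppingTime ℱ (τ k)) →
      eLpNorm (fun ω => ellNorm r fun k =>
          supParaprodFrom (fun s t => F k s t ω) (fun n => g k n ω) (τ' k ω) (τ k ω)) q P
        ≤ C * (eLpNorm (fun ω => ellNorm r₁ fun k =>
              supFrom (fun s t => F k s t ω) (τ' k ω) (τ k ω)) q₁ P
            * eLpNorm (fun ω => ellNorm r₀ fun k =>
              sqFun (fun n => g k n ω) (τ' k ω) (τ k ω)) q₀ P) := by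
  have hq' : q ≠ ∞ := ne_top_of_le_ne_top hq₀' (ENNReal.HolderTriple.le q₀ q₁ q)
  have hr₀ : r ≤ r₀ := ENNReal.HolderTriple.le r₀ r₁ r
  have hr₁ : r ≤ r₁ := ENNReal.HolderTriple.le r₁ r₀ r
  have hr0 : r ≠ 0 := (one_pos.trans_le hr).ne'
  have hr' : r ≠ ∞ := ne_top_of_le_ne_top hr₀' hr₀
  obtain ⟨C, hC⟩ := exists_eLpNorm_ellMaxSum_mul_le.{u, v} hq hq' hq₁ hq₀ hq₀' hr hr'
    (one_pos.trans_le (hr.trans hr₁)).ne' (hr.trans hr₀) hr₀'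
  refine ⟨C, fun Ω m P _ ℱ ι _ g F τ' τ hg hF hτ' hτ => ?_⟩
  let d : ι → ℕ → Ω → ℝ := fun k j ω => localIncr (fun n => g k n ω) (τ' k ω) (τ k ω) j
  let f : ι → ℕ → Ω → ℝ := fun k j ω => localIntegrand (fun s t => F k s t ω) (τ' k ω) (τ k ω) j
  simp only [supParaprodFrom_eq_iSup_maxPartialSum]
  refine (eLpNorm_ellNorm_iSup_le hq hq' hr0 hr' (fun k N => measurable_maxPartialSum fun j _ =>
    measurable_localIntegrand_mul_localIncr (hg k) (hF k) (hτ' k) (hτ k) j)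
    fun k ω => maxPartialSum_mono _).trans (iSup_le fun ⟨s, N⟩ => ?_)
  refine (hC Ω P ℱ s (fun k => d k) (fun k => f k)
    (fun k => isMartingaleDiff_localIncr (hg k) (hτ' k) (hτ k))
    (fun k => adapted_localIntegrand (hF k) (hτ' k) (hτ k)) N).trans ?_
  gcongr
  · exact eLpNorm_mono_enorm fun ω => (ellNorm_mono fun k => maxAbs_localIntegrand_le _ _ _ N).trans
      (ellNorm_comp_le_of_injective Subtype.val_injective _)
  · exact eLpNorm_mono_enorm fun ω => (ellNorm_mono fun k => squareFn_localIncr_le _ _ _ N).trans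
      (ellNorm_comp_le_of_injective Subtype.val_injective _)

variable {ι Ω : Type*} [Countable ι] {m : MeasurableSpace Ω} {ℱ : Filtration ℕ m}
  {P : Measure Ω} {g : ι → ℕ → Ω → ℝ} {F : ι → ℕ → ℕ → Ω → ℝ} {τ' τ : ι → Ω → WithTop ℕ}
  {q r : ℝ≥0∞}

theorem ellNorm_supParaprod_le {ι : Type*} {r : ℝ≥0∞} (hr : 1 ≤ r) (F : ι → ℕ → ℕ → ℝ)
    (g : ι → ℕ → ℝ) (a b : ι → WithTop ℕ) :
    ellNorm r (fun k => supParaprod (F k) (g k) (a k) (b k))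
      ≤ ellNorm r (fun k => supParaprod (deltaFst ((a k).untopD 0) (F k)) (g k) (a k) (b k))
        + (2 : ℝ≥0) * ellNorm r fun k => supParaprodFrom (F k) (g k) (a k) (b k) := by
  rw [← ellNorm_const_mul (one_pos.trans_le hr).ne']
  exact (ellNorm_mono fun k => supParaprod_le _ _ _ _).trans (ellNorm_add_le hr _ _)

theorem eLpNorm_supParaprod_le (hq : 1 ≤ q) (hr : 1 ≤ r)
    (hg : ∀ k, Martingale (g k) ℱ P) (hF : ∀ k, AdaptedTwo ℱ (F k))
    (hτ' : ∀ k, IsStoppingTime ℱ (τ' k)) (hτ : ∀ k, IsStoppingTime ℱ (τ k)) :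
    eLpNorm (fun ω => ellNorm r fun k =>
        supParaprod (fun s t => F k s t ω) (fun n => g k n ω) (τ' k ω) (τ k ω)) q P
      ≤ eLpNorm (fun ω => ellNorm r fun k =>
          supParaprod (deltaFst ((τ' k ω).untopD 0) fun s t => F k s t ω)
            (fun n => g k n ω) (τ' k ω) (τ k ω)) q P
        + 2 * eLpNorm (fun ω => ellNorm r fun k =>
          supParaprodFrom (fun s t => F k s t ω) (fun n => g k n ω) (τ' k ω) (τ k ω)) q P := by
  refine (eLpNorm_mono_enorm fun ω => ellNorm_supParaprod_le hr _ _ _ _).trans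
    ((eLpNorm_ennreal_add_le hq _ ?_).trans_eq ?_)
  · exact ((measurable_ellNorm fun k => measurable_supParaprodFrom (hg k) (hF k) (hτ' k)
      (hτ k)).const_mul _).aemeasurable
  · rw [eLpNorm_ennreal_const_mul, ENNReal.coe_ofNat]

theorem eLpNorm_supParaprod_rpow_le (hq : q ≠ 0) (hq' : q ≤ 1) (hr : 1 ≤ r)
    (hg : ∀ k, Martingale (g k) ℱ P) (hF : ∀ k, AdaptedTwo ℱ (F k))
    (hτ' : ∀ k, IsStoppingTime ℱ (τ' k)) (hτ : ∀ k, IsStoppingTime ℱ (τ k)) :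
    eLpNorm (fun ω => ellNorm r fun k =>
        supParaprod (fun s t => F k s t ω) (fun n => g k n ω) (τ' k ω) (τ k ω)) q P ^ q.toReal
      ≤ eLpNorm (fun ω => ellNorm r fun k =>
          supParaprod (deltaFst ((τ' k ω).untopD 0) fun s t => F k s t ω)
            (fun n => g k n ω) (τ' k ω) (τ k ω)) q P ^ q.toReal
        + (2 * eLpNorm (fun ω => ellNorm r fun k =>
          supParaprodFrom (fun s t => F k s t ω) (fun n => g k n ω) (τ' k ω) (τ k ω)) q P)
            ^ q.toReal := by
  refine (ENNReal.rpow_le_rpow (eLpNorm_mono_enorm fun ω => ellNorm_supParaprod_le hr _ _ _ _)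
    ENNReal.toReal_nonneg).trans ((eLpNorm_ennreal_add_rpow_le hq hq' _ ?_).trans_eq ?_)
  · exact ((measurable_ellNorm fun k => measurable_supParaprodFrom (hg k) (hF k) (hτ' k)
      (hτ k)).const_mul _).aemeasurable
  · rw [eLpNorm_ennreal_const_mul, ENNReal.coe_ofNat]

end Estimates

end VVParaproduct

open VVParaproduct in
theorem theorem2p6_general.{u, v} {q q₀ q₁ r r₀ r₁ : ℝ≥0∞}
    (hq₁ : 0 < q₁) (hq₀ : 1 ≤ q₀) (hq₀' : q₀ < ∞) (hr : 1 ≤ r) (hr₀' : r₀ < ∞)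
    (hqq : 1 / q = 1 / q₀ + 1 / q₁) (hrr : 1 / r = 1 / r₀ + 1 / r₁) :
    ∃ C : ℝ≥0, ∀ (ι : Type v) [Countable ι] (Ω : Type u) [m : MeasurableSpace Ω] (P : Measure Ω)
      [IsFiniteMeasure P] (ℱ : Filtration ℕ m) (g : ι → ℕ → Ω → ℝ) (F : ι → ℕ → ℕ → Ω → ℝ)
      (τ' τ : ι → Ω → WithTop ℕ),
      (∀ k, Martingale (g k) ℱ P) →
      (∀ k, AdaptedTwo ℱ (F k)) →
      (∀ k, IsStoppingTime ℱ (τ' k)) →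
      (∀ k, IsStoppingTime ℱ (τ k)) →
      eLpNorm (fun ω => ellNorm r fun k =>
          supParaprodFrom (fun s t => F k s t ω) (fun n => g k n ω) (τ' k ω) (τ k ω)) q P
        ≤ C * eLpNorm (fun ω => ellNorm r₁ fun k =>
              supFrom (fun s t => F k s t ω) (τ' k ω) (τ k ω)) q₁ P
            * eLpNorm (fun ω => ellNorm r₀ fun k =>
              sqFun (fun n => g k n ω) (τ' k ω) (τ k ω)) q₀ P
      ∧
      (1 ≤ q →
        eLpNorm (fun ω => ellNorm r fun k =>
            supParaprod (fun s t => F k s t ω) (fun n => g k n ω) (τ' k ω) (τ k ω)) q P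
          ≤ eLpNorm (fun ω => ellNorm r fun k =>
              supParaprod (deltaFst ((τ' k ω).untopD 0) fun s t => F k s t ω)
                (fun n => g k n ω) (τ' k ω) (τ k ω)) q P
            + C * eLpNorm (fun ω => ellNorm r₁ fun k =>
                supTwo (fun s t => F k s t ω) (τ' k ω) (τ k ω)) q₁ P
              * eLpNorm (fun ω => ellNorm r₀ fun k =>
                sqFun (fun n => g k n ω) (τ' k ω) (τ k ω)) q₀ P)
      ∧
      (q < 1 →
        (eLpNorm (fun ω => ellNorm r fun k =>
            supParaprod (fun s t => F k s t ω) (fun n => g k n ω) (τ' k ω) (τ k ω)) q P)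
            ^ q.toReal
          ≤ (eLpNorm (fun ω => ellNorm r fun k =>
              supParaprod (deltaFst ((τ' k ω).untopD 0) fun s t => F k s t ω)
                (fun n => g k n ω) (τ' k ω) (τ k ω)) q P) ^ q.toReal
            + (C * eLpNorm (fun ω => ellNorm r₁ fun k =>
                supTwo (fun s t => F k s t ω) (τ' k ω) (τ k ω)) q₁ P
              * eLpNorm (fun ω => ellNorm r₀ fun k =>
                sqFun (fun n => g k n ω) (τ' k ω) (τ k ω)) q₀ P) ^ q.toReal) := by
  have : ENNReal.HolderTriple q₁ q₀ q := ⟨by simpa [add_comm] using hqq.symm⟩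
  have : ENNReal.HolderTriple r₁ r₀ r := ⟨by simpa [add_comm] using hrr.symm⟩
  have hq : q ≠ 0 := by
    rintro rfl
    simp [eq_comm, hq₁.ne', (one_pos.trans_le hq₀).ne'] at hqq
  obtain ⟨C, hC⟩ :=
    exists_eLpNorm_supParaprodFrom_le.{u, v} (r₁ := r₁) hq hq₁.ne' hq₀ hq₀'.ne hr hr₀'.ne
  refine ⟨2 * C, fun ι _ Ω m P _ ℱ g F τ' τ hg hF hτ' hτ => ?_⟩
  have hFrom := hC Ω P ℱ ι g F τ' τ hg hF hτ' hτ
  have hsup : eLpNorm (fun ω => ellNorm r₁ fun k =>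
        supFrom (fun s t => F k s t ω) (τ' k ω) (τ k ω)) q₁ P
      ≤ eLpNorm (fun ω => ellNorm r₁ fun k =>
        supTwo (fun s t => F k s t ω) (τ' k ω) (τ k ω)) q₁ P :=
    eLpNorm_mono_enorm fun ω => ellNorm_mono fun k => supFrom_le_supTwo _ _ _
  have hTwo := hFrom.trans (mul_le_mul_right (mul_le_mul_left hsup _) _)
  simp only [ENNReal.coe_mul, ENNReal.coe_ofNat, mul_assoc]
  refine ⟨hFrom.trans (le_mul_of_one_le_left' one_le_two), fun hq1 => ?_, fun hq1 => ?_⟩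
  · exact (eLpNorm_supParaprod_le hq1 hr hg hF hτ' hτ).trans (by gcongr)
  · exact (eLpNorm_supParaprod_rpow_le hq hq1.le hr hg hF hτ' hτ).trans (by gcongr)

open VVParaproduct in
theorem theorem2p6 (q q₀ q₁ r r₀ r₁ : ℝ≥0∞)
    (hq : 0 < q) (hq₁ : 0 < q₁) (hq₀ : 1 ≤ q₀) (hq₀' : q₀ < ∞)
    (hr : 1 ≤ r) (hr' : r < ∞) (hr₀ : 1 ≤ r₀) (hr₀' : r₀ < ∞) (hr₁ : 1 ≤ r₁)
    (hqq : 1 / q = 1 / q₀ + 1 / q₁) (hrr : 1 / r = 1 / r₀ + 1 / r₁) :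
    ∃ C : ℝ≥0, ∀ (Ω : Type*) [m : MeasurableSpace Ω] (P : Measure Ω) [IsProbabilityMeasure P]
      (ℱ : Filtration ℕ m) (g : ℤ → ℕ → Ω → ℝ) (F : ℤ → ℕ → ℕ → Ω → ℝ)
      (τ' τ : ℤ → Ω → WithTop ℕ),
      (∀ k, Martingale (g k) ℱ P) →
      (∀ k, AdaptedTwo ℱ (F k)) →
      (∀ k, IsStoppingTime ℱ (τ' k)) →
      (∀ k, IsStoppingTime ℱ (τ k)) →
      (∀ k ω, τ' k ω ≤ τ k ω) →
      -- the estimate with the left endpoint fixed at `τ'_k`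
      eLpNorm (fun ω => ellNorm r fun k =>
          supParaprodFrom (fun s t => F k s t ω) (fun n => g k n ω) (τ' k ω) (τ k ω)) q P
        ≤ C * eLpNorm (fun ω => ellNorm r₁ fun k =>
              supFrom (fun s t => F k s t ω) (τ' k ω) (τ k ω)) q₁ P
            * eLpNorm (fun ω => ellNorm r₀ fun k =>
              sqFun (fun n => g k n ω) (τ' k ω) (τ k ω)) q₀ P
      ∧
      -- the estimate with the two-parameter supremum, for `q ≥ 1`
      (1 ≤ q →
        eLpNorm (fun ω => ellNorm r fun k =>
            supParaprod (fun s t => F k s t ω) (fun n => g k n ω) (τ' k ω) (τ k ω)) q P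
          ≤ eLpNorm (fun ω => ellNorm r fun k =>
              supParaprod (deltaFst ((τ' k ω).untopD 0) fun s t => F k s t ω)
                (fun n => g k n ω) (τ' k ω) (τ k ω)) q P
            + C * eLpNorm (fun ω => ellNorm r₁ fun k =>
                supTwo (fun s t => F k s t ω) (τ' k ω) (τ k ω)) q₁ P
              * eLpNorm (fun ω => ellNorm r₀ fun k =>
                sqFun (fun n => g k n ω) (τ' k ω) (τ k ω)) q₀ P)
      ∧
      -- the same for `q < 1`, where the triangle inequality holds for the `q`-th power of the
      -- `L^q` quasinorm
      (q < 1 →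
        (eLpNorm (fun ω => ellNorm r fun k =>
            supParaprod (fun s t => F k s t ω) (fun n => g k n ω) (τ' k ω) (τ k ω)) q P)
            ^ q.toReal
          ≤ (eLpNorm (fun ω => ellNorm r fun k =>
              supParaprod (deltaFst ((τ' k ω).untopD 0) fun s t => F k s t ω)
                (fun n => g k n ω) (τ' k ω) (τ k ω)) q P) ^ q.toReal
            + (C * eLpNorm (fun ω => ellNorm r₁ fun k =>
                supTwo (fun s t => F k s t ω) (τ' k ω) (τ k ω)) q₁ P
              * eLpNorm (fun ω => ellNorm r₀ fun k =>
                sqFun (fun n => g k n ω) (τ' k ω) (τ k ω)) q₀ P) ^ q.toReal) := by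
  obtain ⟨C, hC⟩ := theorem2p6_general hq₁ hq₀ hq₀' hr hr₀' hqq hrr
  exact ⟨C, fun Ω _ P _ ℱ g F τ' τ hg hF hτ' hτ _ => hC ℤ Ω P ℱ g F τ' τ hg hF hτ' hτ⟩
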